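/- Let $G$ be an abelian group (not necessarily finite) and let $K$ be an algebraically closed field of characteristic zero. Let $U=UT(n_1,\dots,n_t)$, $n_i\geq 1$, be the algebra of upper block triangular matrices over $K$ whose $(i,j)$ block, $i\le j$, has size $n_i\times n_j$, and let $U=\bigoplus_{g\in G}U_g$ be any $G$-grading on $U$ (a decomposition into subspaces with $U_gU_h\subseteq U_{gh}$). Then there exist a finite subgroup $T\subseteq G$, a 2-cocycle $\sigma:T\times T\to K^\times$ (for the trivial action), an integer $m$ with $m^2=|T|$, non-negative integers $n_1',\dots,n_t'$ with $n_i=n_i'm=n_i'\sqrt{|T|}$ for each $i$, and an elementary $G$-grading on $U'=UT(n_1',\dots,n_t')$, such that $K^\sigma T\cong M_m(K)$ as algebras and $$U\;\cong\; U'\otimes_K K^\sigma T$$ as $G$-graded algebras. Here $K^\sigma T$ is the twisted group algebra, with basis $(X_s)_{s\in T}$ and product $X_sX_u=\sigma(s,u)X_{su}$, graded by $\deg X_s=s$. A $G$-grading on $UT(n_1',\dots,n_t')$ is elementary if there are $\gamma_1,\dots,\gamma_N\in G$, $N=\sum_i n_i'$, such that every matrix unit $e_{pq}$ in the algebra is homogeneous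 of degree $\gamma_p\gamma_q^{-1}$. The tensor product is graded by $\deg(a\otimes b)=\deg a\,\deg b$ for homogeneous $a$, $b$. -/

import Mathlib

open scoped TensorProduct

/-! ### Group gradings -/

/-- `𝒜` is a `G`-grading on the `K`-algebra `A`: there is a vector space decomposition
`A = ⨁ g, 𝒜 g` (some `𝒜 g` may be zero) with `𝒜 g * 𝒜 h ⊆ 𝒜 (g * h)`. -/
structure IsGroupGrading {G K A : Type*} [Group G] [Field K] [Ring A] [Algebra K A]
    (𝒜 : G → Submodule K A) : Prop where
  isInternal : letI := Classical.decEq G; DirectSum.IsInternal 𝒜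
  mul_mem : ∀ (g h : G) (a b : A), a ∈ 𝒜 g → b ∈ 𝒜 h → a * b ∈ 𝒜 (g * h)

/-- An isomorphism of graded algebras: an isomorphism of algebras that maps the homogeneous
component of degree `g` onto the homogeneous component of degree `g`, for every `g`. -/
def IsGradedIso {G K A B : Type*} [Field K] [Ring A] [Algebra K A] [Ring B] [Algebra K B]
    (𝒜 : G → Submodule K A) (ℬ : G → Submodule K B) (e : A ≃ₐ[K] B) : Prop :=
  ∀ g : G, (𝒜 g).map (e : A →ₐ[K] B).toLinearMap = ℬ g

/-- The homogeneous components of the tensor product of two algebras graded by an abelian group: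
`(A ⊗ B)_g` is spanned by the `a ⊗ b` with `deg a * deg b = g`. -/
def tensorGrading {G K A B : Type*} [CommGroup G] [Field K] [Ring A] [Algebra K A]
    [Ring B] [Algebra K B] (𝒜 : G → Submodule K A) (ℬ : G → Submodule K B) (g : G) :
    Submodule K (A ⊗[K] B) :=
  Submodule.span K {x | ∃ h k : G, h * k = g ∧ ∃ a ∈ 𝒜 h, ∃ b ∈ ℬ k, x = a ⊗ₜ[K] b}

/-! ### Upper block triangular matrices -/

/-- The algebra `UT(n 0, …, n (t-1))` of upper block triangular matrices over `K`. Rows and columns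
are indexed by pairs `⟨i, p⟩` of a block number `i` and a position `p` in that block. -/
def UT (K : Type*) [Field K] {t : ℕ} (n : Fin t → ℕ) :
    Subalgebra K (Matrix (Σ i, Fin (n i)) (Σ i, Fin (n i)) K) where
  carrier := {M | M.BlockTriangular Sigma.fst}
  mul_mem' hM hN := hM.mul hN
  add_mem' hM hN := hM.add hN
  algebraMap_mem' r := by
    rw [Algebra.algebraMap_eq_smul_one]
    intro i j hij
    rw [Matrix.smul_apply, Matrix.blockTriangular_one hij, smul_zero]

/-- A grading on `UT(n)` is elementary if there is a family `γ` of group elements, indexed by the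
rows, such that every matrix unit `e_{pq}` in `UT(n)` is homogeneous of degree `γ p * (γ q)⁻¹`. -/
def IsElementaryGrading {G K : Type*} [Group G] [Field K] {t : ℕ} {n : Fin t → ℕ}
    (𝒜 : G → Submodule K (UT K n)) : Prop :=
  IsGroupGrading 𝒜 ∧ ∃ γ : (Σ i, Fin (n i)) → G,
    ∀ (p q : Σ i, Fin (n i)) (hpq : Matrix.single p q (1 : K) ∈ UT K n),
      (⟨Matrix.single p q 1, hpq⟩ : UT K n) ∈ 𝒜 (γ p * (γ q)⁻¹)

/-! ### Twisted group algebras -/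

/-- A 2-cocycle `σ : T × T → Kˣ` for the trivial action of `T` on `Kˣ` (not assumed to be
normalized). -/
structure TwoCocycle (T K : Type*) [Group T] [Field K] where
  toFun : T → T → Kˣ
  cocycle : ∀ r s u : T, toFun (r * s) u * toFun r s = toFun s u * toFun r (s * u)

/-- The twisted group algebra `K^σ T`: the vector space with basis `(X_s)`, `s ∈ T`, and the product
`X_s * X_u = σ(s, u) X_{su}`. -/
def TwistedGroupAlgebra {T K : Type*} [Group T] [Field K] (_σ : TwoCocycle T K) : Type _ := T →₀ K

namespace TwistedGroupAlgebra

variable {T K : Type*} [Group T] [Field K] (σ : TwoCocycle T K)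

noncomputable instance : AddCommGroup (TwistedGroupAlgebra σ) :=
  inferInstanceAs (AddCommGroup (T →₀ K))

noncomputable instance : Module K (TwistedGroupAlgebra σ) :=
  inferInstanceAs (Module K (T →₀ K))

/-- The element `a X_s`. -/
noncomputable def single (s : T) (a : K) : TwistedGroupAlgebra σ := Finsupp.single s a

/-- The product on the underlying vector space, as a bilinear map. -/
noncomputable def mulBilin : (T →₀ K) →ₗ[K] (T →₀ K) →ₗ[K] (T →₀ K) :=
  Finsupp.lift ((T →₀ K) →ₗ[K] (T →₀ K)) K T fun s =>
    Finsupp.lift (T →₀ K) K T fun u => Finsupp.single (s * u) (σ.toFun s u : K)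

theorem mulBilin_single (s u : T) (a b : K) :
    mulBilin σ (Finsupp.single s a) (Finsupp.single u b)
      = Finsupp.single (s * u) (a * b * σ.toFun s u) := by
  simp [mulBilin, Finsupp.lift_apply, -Finsupp.single_mul, mul_assoc]

/-- The product of `K^σ T`, bilinear with `(a X_s) * (b X_u) = a b σ(s, u) X_{su}`. -/
noncomputable instance : Mul (TwistedGroupAlgebra σ) := ⟨fun x y => mulBilin σ x y⟩

/-- The unit of `K^σ T` is `σ(1, 1)⁻¹ X_1`. -/
noncomputable instance : One (TwistedGroupAlgebra σ) :=
  ⟨single σ 1 ↑(σ.toFun 1 1)⁻¹⟩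

theorem one_def : (1 : TwistedGroupAlgebra σ) = single σ 1 ↑(σ.toFun 1 1)⁻¹ := rfl

theorem single_mul_single (s u : T) (a b : K) :
    single σ s a * single σ u b = single σ (s * u) (a * b * σ.toFun s u) :=
  mulBilin_single σ s u a b

theorem induction_on {p : TwistedGroupAlgebra σ → Prop} (x : TwistedGroupAlgebra σ)
    (h0 : p 0) (hadd : ∀ x y, p x → p y → p (x + y)) (hs : ∀ s a, p (single σ s a)) : p x :=
  Finsupp.induction_linear (motive := p) x h0 hadd hs

theorem cocycle_one_left (u : T) : σ.toFun 1 u = σ.toFun 1 1 := by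
  have h := σ.cocycle 1 1 u
  simp only [one_mul] at h
  exact (mul_left_cancel h).symm

theorem cocycle_one_right (s : T) : σ.toFun s 1 = σ.toFun 1 1 := by
  have h := σ.cocycle s 1 1
  simp only [mul_one] at h
  exact mul_right_cancel h

theorem left_distrib' (x y z : TwistedGroupAlgebra σ) : x * (y + z) = x * y + x * z :=
  map_add (mulBilin σ x) y z

theorem right_distrib' (x y z : TwistedGroupAlgebra σ) : (x + y) * z = x * z + y * z :=
  LinearMap.map_add₂ (mulBilin σ) x y z

theorem zero_mul' (x : TwistedGroupAlgebra σ) : 0 * x = 0 :=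
  LinearMap.map_zero₂ (mulBilin σ) x

theorem mul_zero' (x : TwistedGroupAlgebra σ) : x * 0 = 0 :=
  map_zero (mulBilin σ x)

noncomputable instance : Ring (TwistedGroupAlgebra σ) where
  toAddCommGroup := inferInstance
  left_distrib := left_distrib' σ
  right_distrib := right_distrib' σ
  zero_mul := zero_mul' σ
  mul_zero := mul_zero' σ
  mul_assoc x y z := by
    induction x using induction_on with
    | h0 => simp only [zero_mul']
    | hadd x x' hx hx' => simp only [right_distrib', hx, hx']
    | hs r a =>
    induction y using induction_on with
    | h0 => simp only [zero_mul', mul_zero']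
    | hadd y y' hy hy' => simp only [left_distrib', right_distrib', hy, hy']
    | hs s b =>
    induction z using induction_on with
    | h0 => simp only [mul_zero']
    | hadd z z' hz hz' => simp only [left_distrib', hz, hz']
    | hs u c =>
      have h : (σ.toFun (r * s) u : K) * σ.toFun r s = σ.toFun s u * σ.toFun r (s * u) := by
        exact_mod_cast congrArg Units.val (σ.cocycle r s u)
      rw [single_mul_single, single_mul_single, single_mul_single, single_mul_single, mul_assoc r]
      congr 1
      linear_combination (a * b * c) * h
  one_mul x := by
    induction x using induction_on with
    | h0 => exact mul_zero' σ 1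
    | hadd x y hx hy => rw [left_distrib', hx, hy]
    | hs s a =>
      rw [one_def, single_mul_single, one_mul, cocycle_one_left σ s, mul_right_comm,
        Units.inv_mul, one_mul]
  mul_one x := by
    induction x using induction_on with
    | h0 => exact zero_mul' σ 1
    | hadd x y hx hy => rw [right_distrib', hx, hy]
    | hs s a =>
      rw [one_def, single_mul_single, mul_one, cocycle_one_right σ s, mul_assoc,
        Units.inv_mul, mul_one]

noncomputable instance : Algebra K (TwistedGroupAlgebra σ) :=
  Algebra.ofModule
    (fun c x y => LinearMap.map_smul₂ (mulBilin σ) c x y)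
    (fun c x y => map_smul (mulBilin σ x) c y)

end TwistedGroupAlgebra

/-- The natural `G`-grading on `K^σ T` for a subgroup `T` of `G`: the component of degree `g` is
`K X_g` if `g ∈ T`, and zero otherwise. -/
noncomputable def TwistedGroupAlgebra.grading {G K : Type*} [Group G] [Field K] {T : Subgroup G}
    (σ : TwoCocycle T K) (g : G) : Submodule K (TwistedGroupAlgebra σ) :=
  Submodule.span K {x | ∃ s : T, (s : G) = g ∧ x = TwistedGroupAlgebra.single σ s 1}

/-! ### Homogeneous projections -/

/-- `π` is the family of projections onto the summands of a decomposition `M = ⨁ g, 𝒜 g`. -/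
structure IsHomogeneousProj {G K M : Type*} [Field K] [AddCommGroup M] [Module K M]
    (𝒜 : G → Submodule K M) (π : G → M →ₗ[K] M) : Prop where
  mem : ∀ g x, π g x ∈ 𝒜 g
  self : ∀ g, ∀ x ∈ 𝒜 g, π g x = x
  other : ∀ g h, ∀ x ∈ 𝒜 g, h ≠ g → π h x = 0
  iSup_eq_top : ⨆ g, 𝒜 g = ⊤

section Decomposition

variable {G K M N : Type*} [Field K] [AddCommGroup M] [Module K M] [AddCommGroup N] [Module K N]

theorem exists_isHomogeneousProj {𝒜 : G → Submodule K M}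
    (h : letI := Classical.decEq G; DirectSum.IsInternal 𝒜) : ∃ π, IsHomogeneousProj 𝒜 π := by
  classical
  have h' : DirectSum.IsInternal 𝒜 := by convert h
  let := h'.chooseDecomposition
  refine ⟨fun g => (𝒜 g).subtype ∘ₗ DirectSum.component K G (fun i => 𝒜 i) g ∘ₗ
    (DirectSum.decomposeLinearEquiv 𝒜).toLinearMap, ?_, ?_, ?_, h'.submodule_iSup_eq_top⟩
  · intro g x
    exact Subtype.property _
  · intro g x hx
    exact DirectSum.decompose_of_mem_same 𝒜 hx
  · intro g k x hx hk
    exact DirectSum.decompose_of_mem_ne 𝒜 hx hk.symm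

namespace IsHomogeneousProj

variable {𝒜 : G → Submodule K M} {π : G → M →ₗ[K] M}

theorem isInternal (h : IsHomogeneousProj 𝒜 π) :
    letI := Classical.decEq G; DirectSum.IsInternal 𝒜 := by
  classical
  refine DirectSum.isInternal_submodule_of_iSupIndep_of_iSup_eq_top ?_ h.iSup_eq_top
  intro g
  rw [Submodule.disjoint_def]
  intro x hx hx'
  rw [← h.self g x hx]
  have hle : ⨆ j, ⨆ (_ : j ≠ g), 𝒜 j ≤ LinearMap.ker (π g) :=
    iSup_le fun j => iSup_le fun hj y hy => h.other j g y hy hj.symm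
  exact hle hx'

theorem induction_on (h : IsHomogeneousProj 𝒜 π) {p : M → Prop} (x : M)
    (hm : ∀ g, ∀ y ∈ 𝒜 g, p y) (h0 : p 0) (ha : ∀ y z, p y → p z → p (y + z)) : p x :=
  Submodule.iSup_induction 𝒜 (motive := p) (by rw [h.iSup_eq_top]; trivial) hm h0 ha

theorem exists_sum (h : IsHomogeneousProj 𝒜 π) (x : M) :
    ∃ S : Finset G, ∀ S', S ⊆ S' → ∑ g ∈ S', π g x = x := by
  classical
  induction x using h.induction_on with
  | hm g y hy =>
    refine ⟨{g}, fun S' hS => ?_⟩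
    rw [Finset.sum_eq_single g, h.self g y hy]
    · exact fun k _ hk => h.other g k y hy hk
    · exact fun hg => absurd (hS (Finset.mem_singleton_self g)) hg
  | h0 => exact ⟨∅, by simp⟩
  | ha y z hy hz =>
    obtain ⟨S, hS⟩ := hy
    obtain ⟨S', hS'⟩ := hz
    refine ⟨S ∪ S', fun R hR => ?_⟩
    simp only [map_add, Finset.sum_add_distrib]
    rw [hS R (Finset.union_subset_left hR), hS' R (Finset.union_subset_right hR)]

theorem mem_of_forall (h : IsHomogeneousProj 𝒜 π) {x : M} {P : Submodule K N} {f : M →ₗ[K] N}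
    (hx : ∀ g, f (π g x) ∈ P) : f x ∈ P := by
  obtain ⟨S, hS⟩ := h.exists_sum x
  rw [← hS S subset_rfl, map_sum]
  exact P.sum_mem fun g _ => hx g

theorem eq_zero_of_forall (h : IsHomogeneousProj 𝒜 π) {x : M} {f : M →ₗ[K] N}
    (hx : ∀ g, f (π g x) = 0) : f x = 0 := by
  have := h.mem_of_forall (x := x) (P := ⊥) (f := f) (by simpa using hx)
  simpa using this

theorem mem_iff (h : IsHomogeneousProj 𝒜 π) {x : M} {g : G} :
    x ∈ 𝒜 g ↔ ∀ k, k ≠ g → π k x = 0 := by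
  refine ⟨fun hx k hk => h.other g k x hx hk, fun hx => ?_⟩
  refine h.mem_of_forall (f := LinearMap.id) fun k => ?_
  by_cases hk : k = g
  · subst hk
    exact h.mem k x
  · simp [hx k hk]

/-- A linear map that shifts degrees injectively commutes with the homogeneous projections. -/
theorem map_comm {H : Type*} (h : IsHomogeneousProj 𝒜 π) {ℬ : H → Submodule K N}
    {ρ : H → N →ₗ[K] N} (h' : IsHomogeneousProj ℬ ρ) {f : M →ₗ[K] N} {φ : G → H}
    (hφ : Function.Injective φ) (hf : ∀ g, ∀ x ∈ 𝒜 g, f x ∈ ℬ (φ g)) (g : G) (x : M) :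
    ρ (φ g) (f x) = f (π g x) := by
  induction x using h.induction_on with
  | hm k y hy =>
    by_cases hk : g = k
    · subst hk
      rw [h.self g y hy, h'.self _ _ (hf _ _ hy)]
    · rw [h.other k g y hy hk, map_zero, h'.other _ _ _ (hf _ _ hy) (hφ.ne hk)]
  | h0 => simp
  | ha y z hy hz => simp only [map_add, hy, hz]

theorem exists_finset [FiniteDimensional K M] (h : IsHomogeneousProj 𝒜 π) :
    ∃ S : Finset G, ∀ S', S ⊆ S' → ∀ x, ∑ g ∈ S', π g x = x := by
  classical
  let b := Module.finBasis K M
  choose S hS using fun i => h.exists_sum (b i)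
  refine ⟨Finset.univ.biUnion S, fun S' hS' x => ?_⟩
  have : ∑ g ∈ S', π g = LinearMap.id := by
    refine b.ext fun i => ?_
    rw [LinearMap.sum_apply]
    exact hS i _ ((Finset.subset_biUnion_of_mem S (Finset.mem_univ i)).trans hS')
  simpa using LinearMap.congr_fun this x

/-- Pulling back a decomposition along an injection whose range is a graded subspace. -/
theorem exists_comap (h : IsHomogeneousProj 𝒜 π) {f : N →ₗ[K] M} (hf : Function.Injective f)
    (hr : ∀ g y, ∃ z, f z = π g (f y)) :
    ∃ ρ, IsHomogeneousProj (fun g => (𝒜 g).comap f) ρ := by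
  let ρ : G → N →ₗ[K] N := fun g =>
    (LinearEquiv.ofInjective f hf).symm.toLinearMap ∘ₗ
      LinearMap.codRestrict (LinearMap.range f) (π g ∘ₗ f) (fun y => hr g y)
  have hρ : ∀ g y, f (ρ g y) = π g (f y) := by
    intro g y
    have := LinearEquiv.apply_symm_apply (LinearEquiv.ofInjective f hf)
      (LinearMap.codRestrict (LinearMap.range f) (π g ∘ₗ f) (fun y => hr g y) y)
    exact congrArg Subtype.val this
  have mem : ∀ g y, ρ g y ∈ (𝒜 g).comap f := fun g y => by
    rw [Submodule.mem_comap, hρ]; exact h.mem g _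
  refine ⟨ρ, mem, ?_, ?_, ?_⟩
  · intro g y hy
    apply hf
    rw [hρ, h.self g _ hy]
  · intro g k y hy hk
    apply hf
    rw [hρ, h.other g k _ hy hk, map_zero]
  · rw [eq_top_iff]
    rintro y -
    obtain ⟨S, hS⟩ := h.exists_sum (f y)
    have : y = ∑ g ∈ S, ρ g y := by
      apply hf
      rw [map_sum]
      simp only [hρ]
      exact (hS S subset_rfl).symm
    rw [this]
    exact Submodule.sum_mem _ fun g _ => Submodule.mem_iSup_of_mem g (mem g y)

/-- A family of subspaces that spans and is contained in a decomposition equals it. -/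
theorem eq_of_le (h : IsHomogeneousProj 𝒜 π) {ℬ : G → Submodule K M} (hle : ∀ g, ℬ g ≤ 𝒜 g)
    (htop : ⨆ g, ℬ g = ⊤) (g : G) : ℬ g = 𝒜 g := by
  refine le_antisymm (hle g) fun x hx => ?_
  rw [← h.self g x hx]
  have hx' : x ∈ ⨆ g, ℬ g := by rw [htop]; trivial
  clear hx
  induction hx' using Submodule.iSup_induction' with
  | mem k y hy =>
    by_cases hk : g = k
    · subst hk
      rwa [h.self g y (hle g hy)]
    · rw [h.other k g y (hle k hy) hk]
      exact zero_mem _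
  | zero => simp
  | add y z _ _ hy hz => rw [map_add]; exact add_mem hy hz

end IsHomogeneousProj

end Decomposition

theorem IsGroupGrading.trace_mulLeft_eq_zero {G K A : Type*} [Group G] [Field K] [Ring A]
    [Algebra K A] [FiniteDimensional K A] {𝒜 : G → Submodule K A} (h : IsGroupGrading 𝒜) {g : G}
    (hg : g ≠ 1) {a : A} (ha : a ∈ 𝒜 g) :
    LinearMap.trace K A (LinearMap.mul K A a) = 0 := by
  classical
  have hi : DirectSum.IsInternal 𝒜 := by convert h.isInternal
  exact LinearMap.trace_eq_zero_of_mapsTo_ne hi (fun k => g * k)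
    (fun k hk => hg (mul_eq_right.mp hk)) (fun k x hx => h.mul_mem g k a x ha hx)

theorem eq_zero_of_trace_mulLeft_eq_zero {K A : Type*} [Field K] [CharZero K] [Ring A]
    [Algebra K A] [FiniteDimensional K A] {e : A} (he : e * e = e)
    (htr : LinearMap.trace K A (LinearMap.mul K A e) = 0) : e = 0 := by
  have hid : IsIdempotentElem (LinearMap.mul K A e) := by
    change Algebra.lmul K A e * Algebra.lmul K A e = Algebra.lmul K A e
    rw [← map_mul, he]
  have h0 := LinearMap.IsIdempotentElem.eq_zero_of_trace_eq_zero hid htr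
  simpa using LinearMap.congr_fun h0 1

/-! ### The radical of `UT(n)` is graded -/

namespace UT

variable {G K : Type*} [Field K] {t : ℕ} {n : Fin t → ℕ}

theorem apply_eq_zero (x : UT K n) {p q : Σ i, Fin (n i)} (h : q.1 < p.1) : x.1 p q = 0 :=
  x.2 h

theorem single_mem {p q : Σ i, Fin (n i)} (h : p.1 ≤ q.1) (c : K) :
    Matrix.single p q c ∈ UT K n := by
  intro a b hab
  rw [Matrix.single_apply, if_neg]
  rintro ⟨rfl, rfl⟩
  exact absurd hab (not_lt.mpr h)

variable (K n) in
/-- The strictly block upper triangular matrices. -/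
def strictUpper : Submodule K (UT K n) where
  carrier := {x | ∀ p q, p.1 = q.1 → x.1 p q = 0}
  add_mem' := by
    intro x y hx hy p q h
    simp [hx p q h, hy p q h]
  zero_mem' := fun _ _ _ => rfl
  smul_mem' := by
    intro c x hx p q h
    simp [hx p q h]

theorem strictUpper_apply {x : UT K n} (hx : x ∈ strictUpper K n) {p q : Σ i, Fin (n i)}
    (h : q.1 ≤ p.1) : x.1 p q = 0 := by
  rcases h.lt_or_eq with h | h
  · exact x.2 h
  · exact hx p q h.symm

theorem mul_mem_strictUpper {x : UT K n} (hx : x ∈ strictUpper K n) (y : UT K n) :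
    x * y ∈ strictUpper K n := by
  intro p q hpq
  change (x.1 * y.1) p q = 0
  rw [Matrix.mul_apply]
  refine Finset.sum_eq_zero fun r _ => ?_
  rcases lt_or_ge q.1 r.1 with h | h
  · rw [apply_eq_zero y h, mul_zero]
  · rw [strictUpper_apply hx (h.trans hpq.symm.le), zero_mul]

theorem strictUpper_pow_apply {x : UT K n} (hx : x ∈ strictUpper K n) (k : ℕ) :
    ∀ p q : Σ i, Fin (n i), q.1.val < p.1.val + k → (x ^ k).1 p q = 0 := by
  induction k with
  | zero =>
    intro p q h
    exact apply_eq_zero _ h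
  | succ k ih =>
    intro p q h
    rw [pow_succ]
    change ((x ^ k).1 * x.1) p q = 0
    rw [Matrix.mul_apply]
    refine Finset.sum_eq_zero fun r _ => ?_
    by_cases hr : r.1.val < p.1.val + k
    · rw [ih p r hr, zero_mul]
    · rw [strictUpper_apply hx (p := r) (q := q) (Fin.le_def.mpr (by omega)), mul_zero]

theorem isNilpotent_of_mem_strictUpper {x : UT K n} (hx : x ∈ strictUpper K n) :
    IsNilpotent x := by
  refine ⟨t, Subtype.ext (Matrix.ext fun p q => ?_)⟩
  exact strictUpper_pow_apply hx t p q (by have := q.1.2; omega)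

/-- The radical is a graded ideal, by nondegeneracy of the trace form modulo the radical. -/
theorem proj_mem_strictUpper [CharZero K] [Group G] {𝒰 : G → Submodule K (UT K n)}
    (h : IsGroupGrading 𝒰) {π : G → UT K n →ₗ[K] UT K n} (hπ : IsHomogeneousProj 𝒰 π)
    {x : UT K n} (hx : x ∈ strictUpper K n) (g : G) : π g x ∈ strictUpper K n := by
  classical
  let τ : UT K n →ₗ[K] K := LinearMap.trace K (UT K n) ∘ₗ LinearMap.mul K (UT K n)
  have hτ0 : ∀ k, k ≠ 1 → ∀ a ∈ 𝒰 k, τ a = 0 := fun k hk a ha =>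
    h.trace_mulLeft_eq_zero hk ha
  have hτx : ∀ y, τ (x * y) = 0 := fun y => by
    have h1 : IsNilpotent (LinearMap.mul K (UT K n) (x * y)) :=
      (isNilpotent_of_mem_strictUpper (mul_mem_strictUpper hx y)).map
        (Algebra.lmul K (UT K n))
    exact (LinearMap.isNilpotent_trace_of_isNilpotent h1).eq_zero
  have key : ∀ y, τ (π g x * y) = 0 := by
    intro y
    induction y using hπ.induction_on with
    | hm k y hy =>
      by_cases hk : g * k = 1
      · obtain ⟨S, hS⟩ := hπ.exists_sum x
        have e := hτx y
        rw [← hS (insert g S) (Finset.subset_insert _ _), Finset.sum_mul, map_sum,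
          Finset.sum_eq_single g] at e
        · exact e
        · intro l _ hl
          refine hτ0 (l * k) (fun hlk => hl ?_) _ (h.mul_mem _ _ _ _ (hπ.mem _ _) hy)
          exact mul_right_cancel (hlk.trans hk.symm)
        · intro hg
          exact absurd (Finset.mem_insert_self _ _) hg
      · exact hτ0 _ hk _ (h.mul_mem _ _ _ _ (hπ.mem _ _) hy)
    | h0 => simp
    | ha y z hy hz => rw [mul_add, map_add, hy, hz, add_zero]
  intro p q hpq
  by_contra hc
  set a := π g x with ha
  set y : UT K n := ⟨Matrix.single q p 1, single_mem hpq.symm.le 1⟩ with hy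
  have hz : ∀ r s, (a * y).1 r s = if s = p then a.1 r q else 0 := by
    intro r s
    change (a.1 * Matrix.single q p (1 : K)) r s = _
    split_ifs with hs
    · subst hs; simp
    · rw [Matrix.mul_single_apply_of_ne _ _ _ _ _ hs]
  have hzz : (a * y) * (a * y) = a.1 p q • (a * y) := by
    refine Subtype.ext (Matrix.ext fun r s => ?_)
    change ((a * y).1 * (a * y).1) r s = a.1 p q * (a * y).1 r s
    rw [Matrix.mul_apply]
    simp only [hz]
    by_cases hs : s = p
    · simp [hs, mul_comm]
    · simp [hs]
  set e : UT K n := (a.1 p q)⁻¹ • (a * y) with he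
  have hee : e * e = e := by
    rw [he, smul_mul_smul_comm, hzz, smul_smul, mul_assoc, inv_mul_cancel₀ hc, mul_one]
  have htr : LinearMap.trace K (UT K n) (LinearMap.mul K (UT K n) e) = 0 := by
    change τ e = 0
    rw [he, map_smul, key, smul_zero]
  have h1 : e = 0 := eq_zero_of_trace_mulLeft_eq_zero hee htr
  have h2 : e.1 p p = 1 := by
    change (a.1 p q)⁻¹ * (a * y).1 p p = 1
    rw [hz, if_pos rfl, inv_mul_cancel₀ hc]
  rw [h1] at h2
  exact zero_ne_one h2

end UT

/-! ### Graded modules of matrices -/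

/-- `𝒲` makes the left `UT(n)`-module of matrices with `m` columns a graded module. -/
structure IsCompatibleGrading {G K : Type*} [Group G] [Field K] {t : ℕ} {n : Fin t → ℕ}
    (𝒰 : G → Submodule K (UT K n)) {m : ℕ}
    (𝒲 : G → Submodule K (Matrix (Σ i, Fin (n i)) (Fin m) K)) : Prop where
  isInternal : letI := Classical.decEq G; DirectSum.IsInternal 𝒲
  mul_mem : ∀ (g h : G) (x : UT K n) (w : Matrix (Σ i, Fin (n i)) (Fin m) K),
    x ∈ 𝒰 g → w ∈ 𝒲 h → x.1 * w ∈ 𝒲 (g * h)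

/-- The matrices whose rows in the blocks with numbers at least `k` vanish. -/
def rowFlag (K : Type*) [Field K] {t : ℕ} (n : Fin t → ℕ) (m k : ℕ) :
    Submodule K (Matrix (Σ i, Fin (n i)) (Fin m) K) where
  carrier := {w | ∀ p c, k ≤ p.1.val → w p c = 0}
  add_mem' := by
    intro x y hx hy p c h
    simp [hx p c h, hy p c h]
  zero_mem' := fun _ _ _ => rfl
  smul_mem' := by
    intro a x hx p c h
    simp [hx p c h]

section

variable {G K : Type*} [Group G] [Field K] {t : ℕ} {n : Fin t → ℕ} {m : ℕ}

theorem rowFlag_mono {k l : ℕ} (h : k ≤ l) : rowFlag K n m k ≤ rowFlag K n m l :=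
  fun _ hw p c hp => hw p c (h.trans hp)

theorem rowFlag_zero : rowFlag K n m 0 = ⊥ := by
  rw [eq_bot_iff]
  intro w hw
  exact Matrix.ext fun p c => hw p c (Nat.zero_le _)

variable (m) in
/-- The action of `UT(n)` on matrices with `m` columns, as a bilinear map. -/
def UT.actBilin : UT K n →ₗ[K] Matrix (Σ i, Fin (n i)) (Fin m) K →ₗ[K]
    Matrix (Σ i, Fin (n i)) (Fin m) K :=
  LinearMap.mk₂ K (fun x w => x.1 * w)
    (fun _ _ _ => Matrix.add_mul _ _ _) (fun _ _ _ => Matrix.smul_mul _ _ _)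
    (fun _ _ _ => Matrix.mul_add _ _ _) (fun _ _ _ => Matrix.mul_smul _ _ _)

@[simp]
theorem UT.actBilin_apply (x : UT K n) (w : Matrix (Σ i, Fin (n i)) (Fin m) K) :
    UT.actBilin m x w = x.1 * w := rfl

variable {𝒰 : G → Submodule K (UT K n)} {π : G → UT K n →ₗ[K] UT K n}
  {𝒲 : G → Submodule K (Matrix (Σ i, Fin (n i)) (Fin m) K)}
  {ρ : G → Matrix (Σ i, Fin (n i)) (Fin m) K →ₗ[K] Matrix (Σ i, Fin (n i)) (Fin m) K}

theorem IsCompatibleGrading.proj_mul (h : IsCompatibleGrading 𝒰 𝒲)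
    (hρ : IsHomogeneousProj 𝒲 ρ) {g : G} {x : UT K n} (hx : x ∈ 𝒰 g) (k : G)
    (w : Matrix (Σ i, Fin (n i)) (Fin m) K) : ρ (g * k) (x.1 * w) = x.1 * ρ k w :=
  hρ.map_comm (φ := fun k => g * k) (f := UT.actBilin m x) hρ (mul_right_injective g)
    (fun k w hw => h.mul_mem g k x w hx hw) k w

theorem IsCompatibleGrading.proj_mem_rowFlag [CharZero K] (hn : ∀ i, 0 < n i)
    (h𝒰 : IsGroupGrading 𝒰) (hπ : IsHomogeneousProj 𝒰 π) (h : IsCompatibleGrading 𝒰 𝒲)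
    (hρ : IsHomogeneousProj 𝒲 ρ) (k : ℕ) :
    ∀ w ∈ rowFlag K n m k, ∀ g, ρ g w ∈ rowFlag K n m k := by
  induction k with
  | zero =>
    intro w hw g
    rw [rowFlag_zero, Submodule.mem_bot] at hw
    rw [hw, map_zero]
    exact zero_mem _
  | succ k ih =>
    intro w hw g p c hp
    let q : Σ i, Fin (n i) := ⟨⟨k, by have := p.1.2; omega⟩, ⟨0, hn _⟩⟩
    have hqp : q.1 < p.1 := Fin.lt_def.mpr hp
    let x : UT K n := ⟨Matrix.single q p 1, UT.single_mem hqp.le 1⟩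
    have hx : x ∈ UT.strictUpper K n := by
      intro a b hab
      change Matrix.single q p 1 a b = 0
      rw [Matrix.single_apply, if_neg]
      rintro ⟨rfl, rfl⟩
      exact hqp.ne hab
    have hmem : x.1 * ρ g w ∈ rowFlag K n m k := by
      refine hπ.mem_of_forall (f := (UT.actBilin m).flip (ρ g w)) fun a => ?_
      change (π a x).1 * ρ g w ∈ _
      rw [← h.proj_mul hρ (hπ.mem a x)]
      refine ih _ ?_ _
      intro r d hr
      rw [Matrix.mul_apply]
      refine Finset.sum_eq_zero fun s _ => ?_
      rcases le_or_gt s.1 r.1 with hs | hs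
      · rw [UT.strictUpper_apply (UT.proj_mem_strictUpper h𝒰 hπ hx a) hs, zero_mul]
      · rw [hw s d (by have := Fin.lt_def.mp hs; omega), mul_zero]
    have := hmem q c le_rfl
    simpa [x] using this

/-- Extend a matrix with `n l` columns by zero to a matrix supported in the block column `l`. -/
def extendLast {l : Fin t} (hl : ∀ i, i ≤ l) :
    Matrix (Σ i, Fin (n i)) (Fin (n l)) K →ₗ[K] UT K n where
  toFun w := ⟨Matrix.of fun p q => if h : q.1 = l then w p (h ▸ q.2) else 0, by
    intro p q hpq
    exact dif_neg (hpq.trans_le (hl p.1)).ne⟩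
  map_add' v w := by
    refine Subtype.ext (Matrix.ext fun p q => ?_)
    by_cases h : q.1 = l <;> simp [h]
  map_smul' a w := by
    refine Subtype.ext (Matrix.ext fun p q => ?_)
    by_cases h : q.1 = l <;> simp [h]

theorem extendLast_apply_last {l : Fin t} (hl : ∀ i, i ≤ l)
    (w : Matrix (Σ i, Fin (n i)) (Fin (n l)) K) (p : Σ i, Fin (n i)) (c : Fin (n l)) :
    (extendLast hl w).1 p ⟨l, c⟩ = w p c := dif_pos rfl

theorem extendLast_apply_of_ne {l : Fin t} (hl : ∀ i, i ≤ l)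
    (w : Matrix (Σ i, Fin (n i)) (Fin (n l)) K) (p q : Σ i, Fin (n i)) (hq : q.1 ≠ l) :
    (extendLast hl w).1 p q = 0 := dif_neg hq

theorem extendLast_mul {l : Fin t} (hl : ∀ i, i ≤ l) (x : UT K n)
    (w : Matrix (Σ i, Fin (n i)) (Fin (n l)) K) :
    extendLast hl (x.1 * w) = x * extendLast hl w := by
  refine Subtype.ext (Matrix.ext fun p q => ?_)
  change _ = (x.1 * (extendLast hl w).1) p q
  by_cases hq : q.1 = l
  · obtain ⟨i, c⟩ := q
    obtain rfl : i = l := hq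
    simp only [Matrix.mul_apply, extendLast_apply_last]
  · simp only [Matrix.mul_apply, extendLast_apply_of_ne hl _ _ _ hq, mul_zero,
      Finset.sum_const_zero]

theorem extendLast_mul_strictUpper {l : Fin t} (hl : ∀ i, i ≤ l)
    (w : Matrix (Σ i, Fin (n i)) (Fin (n l)) K) {y : UT K n} (hy : y ∈ UT.strictUpper K n) :
    extendLast hl w * y = 0 := by
  refine Subtype.ext (Matrix.ext fun p q => ?_)
  change ((extendLast hl w).1 * y.1) p q = 0
  rw [Matrix.mul_apply]
  refine Finset.sum_eq_zero fun r _ => ?_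
  by_cases hr : r.1 = l
  · rw [UT.strictUpper_apply hy (hr.symm ▸ hl q.1), mul_zero]
  · rw [extendLast_apply_of_ne hl _ _ _ hr, zero_mul]

theorem exists_extendLast_eq {l : Fin t} (hl : ∀ i, i ≤ l) (hn : 0 < n l) {x : UT K n}
    (hx : ∀ y ∈ UT.strictUpper K n, x * y = 0) : ∃ w, extendLast hl w = x := by
  refine ⟨Matrix.of fun p c => x.1 p ⟨l, c⟩, Subtype.ext (Matrix.ext fun p q => ?_)⟩
  by_cases hq : q.1 = l
  · obtain ⟨i, c⟩ := q
    obtain rfl : i = l := hq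
    rw [extendLast_apply_last]
    rfl
  · rw [extendLast_apply_of_ne hl _ _ _ hq]
    let r : Σ i, Fin (n i) := ⟨l, ⟨0, hn⟩⟩
    have h := hx ⟨Matrix.single q r 1, UT.single_mem (hl q.1) 1⟩ (by
      intro a b hab
      change Matrix.single q r 1 a b = 0
      rw [Matrix.single_apply, if_neg]
      rintro ⟨rfl, rfl⟩
      exact hq hab)
    have h' : (x.1 * Matrix.single q r (1 : K)) p r = 0 :=
      congrFun (congrFun (congrArg Subtype.val h) p) r
    simpa using h'.symm

theorem exists_isCompatibleGrading [CharZero K] (hn : ∀ i, 0 < n i) (h𝒰 : IsGroupGrading 𝒰)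
    {l : Fin t} (hl : ∀ i, i ≤ l) :
    ∃ 𝒲 : G → Submodule K (Matrix (Σ i, Fin (n i)) (Fin (n l)) K),
      IsCompatibleGrading 𝒰 𝒲 := by
  obtain ⟨π, hπ⟩ := exists_isHomogeneousProj h𝒰.isInternal
  have hinj : Function.Injective (extendLast (K := K) (n := n) hl) := by
    intro v w h
    ext p c
    rw [← extendLast_apply_last hl v, ← extendLast_apply_last hl w, h]
  obtain ⟨ρ, hρ⟩ := hπ.exists_comap hinj fun g w => by
    refine exists_extendLast_eq hl (hn l) fun y hy => ?_
    refine hπ.eq_zero_of_forall (f := LinearMap.mulLeft K (π g (extendLast hl w))) fun k => ?_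
    have hy' := UT.proj_mem_strictUpper h𝒰 hπ hy k
    have := hπ.map_comm (φ := fun a => a * k) (f := LinearMap.mulRight K (π k y)) hπ
      (mul_left_injective k) (fun a x hx => h𝒰.mul_mem a k x _ hx (hπ.mem k y)) g
      (extendLast hl w)
    simp only [LinearMap.mulRight_apply, LinearMap.mulLeft_apply] at this ⊢
    rw [← this, extendLast_mul_strictUpper hl w hy', map_zero]
  refine ⟨_, hρ.isInternal, fun g h x w hx hw => ?_⟩
  rw [Submodule.mem_comap, extendLast_mul]
  exact h𝒰.mul_mem g h x _ hx hw

end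

/-! ### The graded division algebra of homogeneous endomorphisms -/

theorem Matrix.exists_rank_factorization {K : Type*} [Field K] {m : ℕ}
    (d : Matrix (Fin m) (Fin m) K) :
    ∃ r ≤ m, ∃ (a : Matrix (Fin m) (Fin r) K) (b : Matrix (Fin r) (Fin m) K)
      (a' : Matrix (Fin r) (Fin m) K) (b' : Matrix (Fin m) (Fin r) K),
      d = a * b ∧ a' * a = 1 ∧ b * b' = 1 := by
  let f := Matrix.toLin' d
  let e : LinearMap.range f ≃ₗ[K] (Fin (Module.finrank K (LinearMap.range f)) → K) :=
    (Module.finBasis K (LinearMap.range f)).equivFun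
  let A := (LinearMap.range f).subtype ∘ₗ e.symm.toLinearMap
  let B := e.toLinearMap ∘ₗ f.rangeRestrict
  have hA : LinearMap.ker A = ⊥ :=
    LinearMap.ker_eq_bot.mpr ((Submodule.subtype_injective _).comp e.symm.injective)
  have hB : LinearMap.range B = ⊤ :=
    LinearMap.range_eq_top.mpr (e.surjective.comp f.surjective_rangeRestrict)
  obtain ⟨A', hA'⟩ := A.exists_leftInverse_of_injective hA
  obtain ⟨B', hB'⟩ := B.exists_rightInverse_of_surjective hB
  refine ⟨_, (Submodule.finrank_le _).trans_eq (by simp), LinearMap.toMatrix' A,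
    LinearMap.toMatrix' B, LinearMap.toMatrix' A', LinearMap.toMatrix' B', ?_, ?_, ?_⟩
  · rw [← LinearMap.toMatrix'_comp]
    have : A ∘ₗ B = f := by
      refine LinearMap.ext fun x => ?_
      simp [A, B]
    rw [this, LinearMap.toMatrix'_toLin']
  · rw [← LinearMap.toMatrix'_comp, hA', LinearMap.toMatrix'_id]
  · rw [← LinearMap.toMatrix'_comp, hB', LinearMap.toMatrix'_id]

theorem Matrix.mul_left_cancel_of_forall {K ι κ : Type*} [Field K] [Nonempty ι] [Fintype κ]
    [DecidableEq κ] {d d' : Matrix κ κ K} (h : ∀ w : Matrix ι κ K, w * d = w * d') :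
    d = d' := by
  ext a b
  classical
  let p : ι := Classical.arbitrary ι
  simpa using congrFun (congrFun (h (Matrix.single p a 1)) p) b

section

variable {G K : Type*} [CommGroup G] [Field K] {t : ℕ} {n : Fin t → ℕ} {m : ℕ}

/-- The endomorphisms of degree `s` of the graded module `𝒲`, acting from the right. -/
def homogeneousEnd (𝒲 : G → Submodule K (Matrix (Σ i, Fin (n i)) (Fin m) K)) (s : G) :
    Submodule K (Matrix (Fin m) (Fin m) K) where
  carrier := {d | ∀ g, ∀ w ∈ 𝒲 g, w * d ∈ 𝒲 (g * s)}
  add_mem' := by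
    intro x y hx hy g w hw
    rw [Matrix.mul_add]
    exact add_mem (hx g w hw) (hy g w hw)
  zero_mem' := fun g w _ => by
    rw [Matrix.mul_zero]
    exact zero_mem _
  smul_mem' := by
    intro a x hx g w hw
    rw [Matrix.mul_smul]
    exact Submodule.smul_mem _ _ (hx g w hw)

variable {𝒰 : G → Submodule K (UT K n)} {π : G → UT K n →ₗ[K] UT K n}
  {𝒲 : G → Submodule K (Matrix (Σ i, Fin (n i)) (Fin m) K)}
  {ρ : G → Matrix (Σ i, Fin (n i)) (Fin m) K →ₗ[K] Matrix (Σ i, Fin (n i)) (Fin m) K}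

theorem one_mem_homogeneousEnd : (1 : Matrix (Fin m) (Fin m) K) ∈ homogeneousEnd 𝒲 1 := by
  intro g w hw
  rwa [Matrix.mul_one, mul_one]

theorem mul_mem_homogeneousEnd {s u : G} {d d' : Matrix (Fin m) (Fin m) K}
    (hd : d ∈ homogeneousEnd 𝒲 s) (hd' : d' ∈ homogeneousEnd 𝒲 u) :
    d * d' ∈ homogeneousEnd 𝒲 (s * u) := by
  intro g w hw
  rw [← Matrix.mul_assoc, ← mul_assoc]
  exact hd' _ _ (hd _ _ hw)

theorem proj_mul_homogeneousEnd (hρ : IsHomogeneousProj 𝒲 ρ) {s : G}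
    {d : Matrix (Fin m) (Fin m) K} (hd : d ∈ homogeneousEnd 𝒲 s) (g : G)
    (w : Matrix (Σ i, Fin (n i)) (Fin m) K) : ρ (g * s) (w * d) = ρ g w * d :=
  hρ.map_comm (φ := fun k => k * s) (f := mulRightLinearMap _ K d) hρ (mul_left_injective s) hd g w

theorem inv_mem_homogeneousEnd (hρ : IsHomogeneousProj 𝒲 ρ) {s : G}
    {d d' : Matrix (Fin m) (Fin m) K} (hd : d ∈ homogeneousEnd 𝒲 s) (h : d * d' = 1) :
    d' ∈ homogeneousEnd 𝒲 s⁻¹ := by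
  have h' : d' * d = 1 := mul_eq_one_comm.mp h
  intro g w hw
  rw [hρ.mem_iff]
  intro k hk
  have hks : k * s ≠ g := fun e => hk (eq_mul_inv_of_mul_eq e)
  have := proj_mul_homogeneousEnd hρ hd k (w * d')
  rw [Matrix.mul_assoc, h', Matrix.mul_one, hρ.other g _ w hw hks] at this
  rw [← Matrix.mul_one (ρ k (w * d')), ← h, ← Matrix.mul_assoc, ← this, Matrix.zero_mul]

/-- If the number of columns is minimal, then nonzero homogeneous endomorphisms are invertible. -/
theorem isUnit_of_mem_homogeneousEnd (h𝒲 : IsCompatibleGrading 𝒰 𝒲)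
    (hmin : ∀ r, 0 < r → (∃ 𝒲' : G → Submodule K (Matrix (Σ i, Fin (n i)) (Fin r) K),
      IsCompatibleGrading 𝒰 𝒲') → m ≤ r) {s : G} {d : Matrix (Fin m) (Fin m) K}
    (hd : d ∈ homogeneousEnd 𝒲 s) (h0 : d ≠ 0) : IsUnit d := by
  obtain ⟨ρ, hρ⟩ := exists_isHomogeneousProj h𝒲.isInternal
  obtain ⟨r, hr, a, b, a', b', rfl, ha, hb⟩ := d.exists_rank_factorization
  have hr0 : 0 < r := by
    by_contra hr0
    obtain rfl : r = 0 := by omega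
    exact h0 (by ext; simp [Matrix.mul_apply])
  have hmr : m ≤ r := by
    refine hmin r hr0 ?_
    have hinj : Function.Injective (mulRightLinearMap (Σ i, Fin (n i)) K b) := by
      intro v w h
      have h' : v * b = w * b := h
      rw [← Matrix.mul_one v, ← Matrix.mul_one w, ← hb, ← Matrix.mul_assoc, h', Matrix.mul_assoc]
    obtain ⟨ρ', hρ'⟩ := hρ.exists_comap hinj fun g v => by
      refine ⟨ρ (g * s⁻¹) (v * a') * a, ?_⟩
      have := proj_mul_homogeneousEnd hρ hd (g * s⁻¹) (v * a')
      rw [inv_mul_cancel_right, Matrix.mul_assoc v, ← Matrix.mul_assoc a', ha,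
        Matrix.one_mul] at this
      change ρ (g * s⁻¹) (v * a') * a * b = ρ g (v * b)
      rw [this, Matrix.mul_assoc]
    refine ⟨_, hρ'.isInternal, fun g h x w hx hw => ?_⟩
    change x.1 * w * b ∈ 𝒲 (g * h)
    rw [Matrix.mul_assoc]
    exact h𝒲.mul_mem g h x _ hx hw
  obtain rfl : r = m := le_antisymm hr hmr
  exact (IsUnit.of_mul_eq_one _ (mul_eq_one_comm.mp ha)).mul (IsUnit.of_mul_eq_one _ hb)

theorem exists_smul_one_of_mem_homogeneousEnd [IsAlgClosed K] (hm : 0 < m)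
    (hunit : ∀ d ∈ homogeneousEnd 𝒲 1, d ≠ 0 → IsUnit d) {d : Matrix (Fin m) (Fin m) K}
    (hd : d ∈ homogeneousEnd 𝒲 1) : ∃ c : K, d = c • 1 := by
  have : Nonempty (Fin m) := ⟨⟨0, hm⟩⟩
  obtain ⟨c, hc⟩ := spectrum.nonempty_of_isAlgClosed_of_finiteDimensional K d
  refine ⟨c, ?_⟩
  by_contra hne
  refine spectrum.mem_iff.mp hc (hunit _ ?_ ?_)
  · rw [Algebra.algebraMap_eq_smul_one]
    exact sub_mem (Submodule.smul_mem _ _ one_mem_homogeneousEnd) hd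
  · rw [Algebra.algebraMap_eq_smul_one]
    exact fun h => hne (sub_eq_zero.mp h).symm

/-- The endomorphisms of the `UT(n)`-module of matrices are the right multiplications. -/
theorem exists_mul_eq_of_commutes {l : Fin t} (hl : ∀ i, i ≤ l) (hn : 0 < n l)
    (φ : Matrix (Σ i, Fin (n i)) (Fin m) K →ₗ[K] Matrix (Σ i, Fin (n i)) (Fin m) K)
    (hφ : ∀ (x : UT K n) w, φ (x.1 * w) = x.1 * φ w) :
    ∃ d : Matrix (Fin m) (Fin m) K, ∀ w, φ w = w * d := by
  let q : Σ i, Fin (n i) := ⟨l, ⟨0, hn⟩⟩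
  let d : Matrix (Fin m) (Fin m) K := Matrix.of fun c c' => φ (Matrix.single q c 1) q c'
  refine ⟨d, fun w => ?_⟩
  have : φ = mulRightLinearMap _ K d := by
    refine Matrix.ext_linearMap K fun p c => LinearMap.ext_ring ?_
    have h := hφ ⟨Matrix.single p q 1, UT.single_mem (hl p.1) 1⟩ (Matrix.single q c 1)
    simp only [Matrix.single_mul_single_same, mul_one] at h
    change φ (Matrix.single p c (1 : K)) = Matrix.single p c (1 : K) * d
    rw [h]
    ext a b
    by_cases ha : a = p
    · subst ha
      simp [d]
    · simp [Matrix.single_mul_apply_of_ne, ha]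
  rw [this]
  rfl

theorem iSup_homogeneousEnd (hn : ∀ i, 0 < n i) (h𝒰 : IsGroupGrading 𝒰) {l : Fin t}
    (hl : ∀ i, i ≤ l) (h𝒲 : IsCompatibleGrading 𝒰 𝒲) : ⨆ s, homogeneousEnd 𝒲 s = ⊤ := by
  classical
  obtain ⟨π, hπ⟩ := exists_isHomogeneousProj h𝒰.isInternal
  obtain ⟨ρ, hρ⟩ := exists_isHomogeneousProj h𝒲.isInternal
  obtain ⟨S, hS⟩ := hρ.exists_finset
  have : Nonempty (Σ i, Fin (n i)) := ⟨⟨l, ⟨0, hn l⟩⟩⟩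
  rw [eq_top_iff]
  rintro d -
  have hS0 : ∀ h, ∀ w ∈ 𝒲 h, h ∉ S → w = 0 := by
    intro h w hw hh
    rw [← hS S subset_rfl w]
    exact Finset.sum_eq_zero fun g hg => hρ.other h g w hw (fun e => hh (e ▸ hg))
  let φ : G → Matrix (Σ i, Fin (n i)) (Fin m) K →ₗ[K] Matrix (Σ i, Fin (n i)) (Fin m) K :=
    fun s => ∑ g ∈ S, ρ (g * s) ∘ₗ mulRightLinearMap _ K d ∘ₗ ρ g
  have hφ : ∀ s h, ∀ w ∈ 𝒲 h, φ s w = ρ (h * s) (w * d) := by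
    intro s h w hw
    by_cases hh : h ∈ S
    · rw [LinearMap.sum_apply, Finset.sum_eq_single h]
      · change ρ (h * s) (ρ h w * d) = _
        rw [hρ.self h w hw]
      · intro g _ hg
        change ρ (g * s) (ρ g w * d) = _
        rw [hρ.other h g w hw hg, Matrix.zero_mul, map_zero]
      · exact fun h' => absurd hh h'
    · rw [hS0 h w hw hh, map_zero, Matrix.zero_mul, map_zero]
  have hcomm : ∀ s (x : UT K n) w, φ s (x.1 * w) = x.1 * φ s w := by
    intro s x w
    induction w using hρ.induction_on with
    | hm h w hw =>
      induction x using hπ.induction_on with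
      | hm a x hx =>
        rw [hφ s h w hw, hφ s (a * h) _ (h𝒲.mul_mem a h x w hx hw), Matrix.mul_assoc,
          mul_assoc, h𝒲.proj_mul hρ hx]
      | h0 => simp
      | ha y z hy hz =>
        change φ s ((y.1 + z.1) * w) = (y.1 + z.1) * φ s w
        rw [Matrix.add_mul, Matrix.add_mul, map_add, hy, hz]
    | h0 => simp
    | ha y z hy hz => simp only [Matrix.mul_add, map_add, hy, hz]
  choose D hD using fun s => exists_mul_eq_of_commutes hl (hn l) (φ s) (hcomm s)
  let S' : Finset G := (S ×ˢ S).image fun p => p.1⁻¹ * p.2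
  have hsum : d = ∑ s ∈ S', D s := by
    refine Matrix.mul_left_cancel_of_forall (ι := Σ i, Fin (n i)) fun w => ?_
    rw [Matrix.mul_sum]
    simp only [← hD]
    induction w using hρ.induction_on with
    | hm h w hw =>
      by_cases hh : h ∈ S
      · simp only [hφ _ h w hw]
        have e := hS (S'.image fun s => h * s) ?_ (w * d)
        · rwa [Finset.sum_image (fun a _ b _ e => mul_left_cancel e), eq_comm] at e
        intro g hg
        refine Finset.mem_image.mpr ⟨h⁻¹ * g, Finset.mem_image.mpr ⟨(h, g), ?_, rfl⟩, ?_⟩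
        · exact Finset.mem_product.mpr ⟨hh, hg⟩
        · exact mul_inv_cancel_left h g
      · simp [hS0 h w hw hh]
    | h0 => simp
    | ha y z hy hz => simp only [Matrix.add_mul, map_add, Finset.sum_add_distrib, hy, hz]
  rw [hsum]
  refine Submodule.sum_mem _ fun s _ => Submodule.mem_iSup_of_mem s ?_
  intro g w hw
  rw [← hD, hφ s g w hw]
  exact hρ.mem _ _

end

section

variable {G K : Type*} [CommGroup G] [Field K] {t : ℕ} {n : Fin t → ℕ} {m : ℕ}
  {𝒰 : G → Submodule K (UT K n)}
  {𝒲 : G → Submodule K (Matrix (Σ i, Fin (n i)) (Fin m) K)}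
  {ρ : G → Matrix (Σ i, Fin (n i)) (Fin m) K →ₗ[K] Matrix (Σ i, Fin (n i)) (Fin m) K}

theorem IsHomogeneousProj.exists_ne_zero {G K M : Type*} [Field K] [AddCommGroup M] [Module K M]
    [Nontrivial M] {𝒜 : G → Submodule K M} {π : G → M →ₗ[K] M} (h : IsHomogeneousProj 𝒜 π) :
    ∃ g, ∃ w ∈ 𝒜 g, w ≠ 0 := by
  by_contra! hc
  obtain ⟨x, hx⟩ := exists_ne (0 : M)
  exact hx (h.eq_zero_of_forall (f := LinearMap.id) fun g => hc g _ (h.mem g x))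

theorem exists_smul_of_mem_homogeneousEnd [IsAlgClosed K] (hm : 0 < m)
    (hρ : IsHomogeneousProj 𝒲 ρ)
    (hunit : ∀ s, ∀ d ∈ homogeneousEnd 𝒲 s, d ≠ 0 → IsUnit d) {s : G}
    {d d' : Matrix (Fin m) (Fin m) K} (hd : d ∈ homogeneousEnd 𝒲 s)
    (hd' : d' ∈ homogeneousEnd 𝒲 s) (h0 : d ≠ 0) : ∃ c : K, d' = c • d := by
  obtain ⟨e, he⟩ := (hunit s d hd h0).exists_right_inv
  have hmem := mul_mem_homogeneousEnd hd' (inv_mem_homogeneousEnd hρ hd he)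
  rw [mul_inv_cancel] at hmem
  obtain ⟨c, hc⟩ := exists_smul_one_of_mem_homogeneousEnd hm (hunit 1) hmem
  refine ⟨c, ?_⟩
  rw [← mul_one d', ← mul_eq_one_comm.mp he, ← mul_assoc, hc, smul_mul_assoc, one_mul]

/-- The homogeneous endomorphisms form a twisted group algebra of their support. -/
theorem exists_homogeneous_basis_of_isUnit [IsAlgClosed K] (hm : 0 < m)
    [Nonempty (Σ i, Fin (n i))] (hρ : IsHomogeneousProj 𝒲 ρ)
    (hunit : ∀ s, ∀ d ∈ homogeneousEnd 𝒲 s, d ≠ 0 → IsUnit d)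
    (htop : ⨆ s, homogeneousEnd 𝒲 s = ⊤) :
    ∃ (T : Subgroup G) (X : T → Matrix (Fin m) (Fin m) K),
      (∀ s : T, X s ∈ homogeneousEnd 𝒲 (s : G)) ∧ (∀ s, IsUnit (X s)) ∧ LinearIndependent K X ∧
      Submodule.span K (Set.range X) = ⊤ ∧
      ∀ s u, ∃ c : Kˣ, X s * X u = (c : K) • X (s * u) := by
  classical
  have : Nonempty (Fin m) := ⟨⟨0, hm⟩⟩
  let T : Subgroup G :=
    { carrier := {s | ∃ d ∈ homogeneousEnd 𝒲 s, IsUnit d}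
      one_mem' := ⟨1, one_mem_homogeneousEnd, isUnit_one⟩
      mul_mem' := fun ⟨d, hd, hu⟩ ⟨d', hd', hu'⟩ =>
        ⟨d * d', mul_mem_homogeneousEnd hd hd', hu.mul hu'⟩
      inv_mem' := by
        rintro s ⟨d, hd, hu⟩
        obtain ⟨e, he⟩ := hu.exists_right_inv
        exact ⟨e, inv_mem_homogeneousEnd hρ hd he, IsUnit.of_mul_eq_one _ (mul_eq_one_comm.mp he)⟩ }
  choose X hX hXu using fun s : T => s.2
  have hX0 : ∀ s, X s ≠ 0 := fun s => (hXu s).ne_zero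
  refine ⟨T, X, hX, hXu, ?_, ?_, ?_⟩
  · rw [linearIndependent_iff']
    intro S c hc u hu
    obtain ⟨g, w, hw, hw0⟩ := hρ.exists_ne_zero
    have h1 : ρ (g * u) (w * ∑ s ∈ S, c s • X s) = c u • (w * X u) := by
      rw [Matrix.mul_sum, map_sum, Finset.sum_eq_single u]
      · rw [Matrix.mul_smul, map_smul, hρ.self _ _ (hX u g w hw)]
      · intro s _ hs
        rw [Matrix.mul_smul, map_smul, hρ.other _ _ _ (hX s g w hw), smul_zero]
        exact fun e => hs (Subtype.ext (mul_left_cancel e)).symm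
      · exact fun h => absurd hu h
    rw [hc, Matrix.mul_zero, map_zero] at h1
    refine (smul_eq_zero.mp h1.symm).resolve_right fun h => hw0 ?_
    obtain ⟨e, he⟩ := (hXu u).exists_right_inv
    rw [← Matrix.mul_one w, ← he, ← Matrix.mul_assoc, h, Matrix.zero_mul]
  · rw [eq_top_iff, ← htop, iSup_le_iff]
    intro s d hd
    by_cases hd0 : d = 0
    · rw [hd0]
      exact zero_mem _
    · have hs : s ∈ T := ⟨d, hd, hunit s d hd hd0⟩
      obtain ⟨c, hc⟩ := exists_smul_of_mem_homogeneousEnd hm hρ hunit (hX ⟨s, hs⟩) hd (hX0 _)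
      rw [hc]
      exact Submodule.smul_mem _ _ (Submodule.subset_span ⟨_, rfl⟩)
  · intro s u
    obtain ⟨c, hc⟩ := exists_smul_of_mem_homogeneousEnd hm hρ hunit (hX (s * u))
      (mul_mem_homogeneousEnd (hX s) (hX u)) (hX0 _)
    refine ⟨Units.mk0 c ?_, hc⟩
    rintro rfl
    rw [zero_smul] at hc
    exact ((hXu s).mul (hXu u)).ne_zero hc

end

/-! ### Twisted group algebras from bases -/

/-- A basis that is multiplicative up to scalars yields a cocycle. -/
theorem exists_twoCocycle {T K A : Type*} [Group T] [Field K] [Ring A] [Algebra K A] {X : T → A}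
    (hX : LinearIndependent K X) (hmul : ∀ s u, ∃ c : Kˣ, X s * X u = (c : K) • X (s * u)) :
    ∃ σ : TwoCocycle T K, ∀ s u, X s * X u = (σ.toFun s u : K) • X (s * u) := by
  choose f hf using hmul
  refine ⟨⟨f, fun r s u => ?_⟩, hf⟩
  have h := mul_assoc (X r) (X s) (X u)
  rw [hf r s, hf s u, smul_mul_assoc, mul_smul_comm, hf, hf, smul_smul, smul_smul,
    mul_assoc r s u] at h
  have h' := smul_left_injective K (hX.ne_zero _) h
  ext
  push_cast
  rw [mul_comm, h']

theorem TwistedGroupAlgebra.exists_algEquiv {T K A : Type*} [Group T] [Field K] [Ring A]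
    [Algebra K A] (σ : TwoCocycle T K) {X : T → A} (hX : LinearIndependent K X)
    (htop : Submodule.span K (Set.range X) = ⊤)
    (hmul : ∀ s u, X s * X u = (σ.toFun s u : K) • X (s * u)) :
    ∃ e : TwistedGroupAlgebra σ ≃ₐ[K] A, ∀ s a, e (single σ s a) = a • X s := by
  let b : Module.Basis T K A := Module.Basis.mk hX htop.ge
  let e : TwistedGroupAlgebra σ ≃ₗ[K] A := b.repr.symm
  have he : ∀ s a, e (single σ s a) = a • X s := by
    intro s a
    change b.repr.symm (Finsupp.single s a) = _
    rw [Module.Basis.repr_symm_single, Module.Basis.mk_apply]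
  have hm : ∀ x y, e (x * y) = e x * e y := by
    intro x y
    induction x using TwistedGroupAlgebra.induction_on with
    | h0 => rw [zero_mul, map_zero, zero_mul]
    | hadd x x' hx hx' => rw [add_mul, map_add, map_add, add_mul, hx, hx']
    | hs s a =>
    induction y using TwistedGroupAlgebra.induction_on with
    | h0 => rw [mul_zero, map_zero, mul_zero]
    | hadd y y' hy hy' => rw [mul_add, map_add, map_add, mul_add, hy, hy']
    | hs u c =>
      rw [single_mul_single, he, he, he, smul_mul_smul_comm, hmul, smul_smul]
  have h1 : e 1 = 1 := by
    have h := hm 1 (e.symm 1)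
    rw [one_mul, LinearEquiv.apply_symm_apply, mul_one] at h
    exact h.symm
  exact ⟨AlgEquiv.ofLinearEquiv e h1 hm, he⟩

theorem TwistedGroupAlgebra.span_grading {G K : Type*} [Group G] [Field K] {T : Subgroup G}
    (σ : TwoCocycle T K) (x : TwistedGroupAlgebra σ) :
    x ∈ Submodule.span K (Set.range fun s : T => single σ s 1) := by
  induction x using TwistedGroupAlgebra.induction_on with
  | h0 => exact zero_mem _
  | hadd x y hx hy => exact add_mem hx hy
  | hs s a =>
    have : single σ s a = a • single σ s 1 := by
      change (Finsupp.single s a : T →₀ K) = a • (Finsupp.single s 1 : T →₀ K)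
      rw [Finsupp.smul_single, smul_eq_mul, mul_one]
    rw [this]
    exact Submodule.smul_mem _ _ (Submodule.subset_span ⟨s, rfl⟩)

/-! ### Bases adapted to a flag -/

theorem exists_linearIndepOn_adapted {K M : Type*} [Field K] [AddCommGroup M] [Module K M]
    {F : ℕ → Submodule K M} (hF : Monotone F) (hF0 : F 0 = ⊥) (H : Set M) (k : ℕ) :
    ∃ b : Set M, b ⊆ H ∩ F k ∧ LinearIndepOn K id b ∧
      ∀ j ≤ k, H ∩ F j ⊆ Submodule.span K (b ∩ F j) := by
  induction k with
  | zero =>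
    refine ⟨∅, Set.empty_subset _, linearIndepOn_empty K id, fun j hj w hw => ?_⟩
    obtain rfl : j = 0 := by omega
    have : w ∈ F 0 := hw.2
    rw [hF0, Submodule.mem_bot] at this
    rw [this]
    exact zero_mem _
  | succ k ih =>
    obtain ⟨b, hb, hli, hsp⟩ := ih
    obtain ⟨b', hb', hbb', hsp', hli'⟩ := exists_linearIndepOn_id_extension hli
      (hb.trans (Set.inter_subset_inter_right H (hF k.le_succ)) : b ⊆ H ∩ F (k + 1))
    refine ⟨b', hb', hli', fun j hj w hw => ?_⟩
    rcases hj.lt_or_eq with hj | rfl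
    · exact Submodule.span_mono (Set.inter_subset_inter_left _ hbb') (hsp j (by omega) hw)
    · rw [Set.inter_eq_left.mpr (hb'.trans Set.inter_subset_right)]
      exact hsp' hw

theorem exists_adapted_family {K M : Type*} [Field K] [AddCommGroup M] [Module K M]
    [FiniteDimensional K M] {F : ℕ → Submodule K M} (hF : Monotone F) (hF0 : F 0 = ⊥)
    (H : Set M) (t : ℕ) :
    ∃ (n : Fin t → ℕ) (v : (Σ i, Fin (n i)) → M), LinearIndependent K v ∧ (∀ p, v p ∈ H) ∧
      (∀ p, v p ∈ F (p.1 + 1)) ∧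
      ∀ k ≤ t, H ∩ F k ⊆ Submodule.span K (v '' {p | p.1.val < k}) := by
  obtain ⟨b, hb, hli, hsp⟩ := exists_linearIndepOn_adapted hF hF0 H t
  have hfin : b.Finite := hli.linearIndependent.setFinite
  let c : Fin t → Set M := fun i => {w | w ∈ b ∧ w ∈ F (i + 1) ∧ w ∉ F i}
  have hc : ∀ i, Finite (c i) := fun i => (hfin.subset fun w hw => hw.1).to_subtype
  let e : ∀ i, Fin (Nat.card (c i)) ≃ c i := fun i => (Finite.equivFin (c i)).symm
  let v : (Σ i, Fin (Nat.card (c i))) → M := fun p => (e p.1 p.2).1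
  have hv : ∀ p, v p ∈ c p.1 := fun p => (e p.1 p.2).2
  have hlev : ∀ (i j : Fin t) w, w ∈ c i → w ∈ c j → i ≤ j := by
    intro i j w hi hj
    by_contra hij
    exact hi.2.2 (hF (Fin.lt_def.mp (not_le.mp hij)) hj.2.1)
  have hinj : Function.Injective v := by
    rintro ⟨i, x⟩ ⟨j, y⟩ h
    have h' : (e i x).1 = (e j y).1 := h
    obtain rfl : i = j := le_antisymm (hlev i j _ (e i x).2 (h' ▸ (e j y).2))
      (hlev j i _ (e j y).2 (h' ▸ (e i x).2))
    rw [(e i).injective (Subtype.ext h')]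
  have hsurj : ∀ w ∈ b, ∃ p, v p = w := by
    classical
    intro w hw
    have hex : ∃ k, w ∈ F k := ⟨t, (hb hw).2⟩
    have h0 : Nat.find hex ≠ 0 := by
      intro h
      have h1 := Nat.find_spec hex
      rw [h, hF0, Submodule.mem_bot] at h1
      exact hli.ne_zero hw h1
    have hle : Nat.find hex ≤ t := Nat.find_min' hex (hb hw).2
    obtain ⟨k, hk⟩ := Nat.exists_eq_succ_of_ne_zero h0
    let i : Fin t := ⟨k, by omega⟩
    have hwi : w ∈ c i := by
      refine ⟨hw, ?_, Nat.find_min hex (by change k < _; omega)⟩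
      change w ∈ F (k + 1)
      rw [← Nat.succ_eq_add_one, ← hk]
      exact Nat.find_spec hex
    exact ⟨⟨i, (e i).symm ⟨w, hwi⟩⟩, congrArg Subtype.val ((e i).apply_symm_apply ⟨w, hwi⟩)⟩
  refine ⟨fun i => Nat.card (c i), v, ?_, fun p => (hb (hv p).1).1, fun p => (hv p).2.1, ?_⟩
  · have := hli.linearIndependent
    exact this.comp (fun p => (⟨v p, (hv p).1⟩ : b)) fun p q h => hinj (congrArg Subtype.val h)
  · intro k hk
    refine (hsp k hk).trans (Submodule.span_mono ?_)
    rintro w ⟨hw, hwk⟩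
    obtain ⟨p, rfl⟩ := hsurj w hw
    refine ⟨p, ?_, rfl⟩
    by_contra hp
    exact (hv p).2.2 (hF (not_lt.mp hp) hwk)

/-! ### Dimensions of the flag -/

theorem card_filter_fst_lt_succ {t : ℕ} (n : Fin t → ℕ) (i : Fin t) :
    (Finset.univ.filter fun p : Σ i, Fin (n i) => p.1.val < i.val + 1).card =
      (Finset.univ.filter fun p : Σ i, Fin (n i) => p.1.val < i.val).card + n i := by
  have h : ∀ k, (Finset.univ.filter fun p : Σ i, Fin (n i) => p.1.val < k) =
      (Finset.univ.filter fun j : Fin t => j.val < k).sigma fun _ => Finset.univ := by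
    intro k
    ext p
    simp
  have h' : (Finset.univ.filter fun j : Fin t => j.val < i.val + 1) =
      insert i (Finset.univ.filter fun j : Fin t => j.val < i.val) := by
    ext j
    simp [Fin.ext_iff]
    omega
  rw [h, h, Finset.card_sigma, Finset.card_sigma, h', Finset.sum_insert (by simp), add_comm]
  simp

theorem finrank_rowFlag (K : Type*) [Field K] {t : ℕ} (n : Fin t → ℕ) (m k : ℕ) :
    Module.finrank K (rowFlag K n m k) =
      (Finset.univ.filter fun p : Σ i, Fin (n i) => p.1.val < k).card * m := by
  let f : rowFlag K n m k →ₗ[K] Matrix {p : Σ i, Fin (n i) // p.1.val < k} (Fin m) K :=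
    { toFun := fun w => Matrix.of fun p c => w.1 p.1 c
      map_add' := fun _ _ => rfl
      map_smul' := fun _ _ => rfl }
  have hf : Function.Bijective f := by
    constructor
    · intro v w h
      refine Subtype.ext (Matrix.ext fun p c => ?_)
      by_cases hp : p.1.val < k
      · exact congrFun (congrFun h ⟨p, hp⟩) c
      · rw [v.2 p c (not_lt.mp hp), w.2 p c (not_lt.mp hp)]
    · intro w
      refine ⟨⟨Matrix.of fun p c => if h : p.1.val < k then w ⟨p, h⟩ c else 0, ?_⟩, ?_⟩
      · intro p c hp
        exact dif_neg (not_lt.mpr hp)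
      · ext p c
        exact dif_pos p.2
  rw [(LinearEquiv.ofBijective f hf).finrank_eq, Module.finrank_matrix, Fintype.card_subtype]
  simp

section

variable {G K : Type*} [CommGroup G] [Field K] {t : ℕ} {n : Fin t → ℕ} {m : ℕ}
  {𝒲 : G → Submodule K (Matrix (Σ i, Fin (n i)) (Fin m) K)}
  {ρ : G → Matrix (Σ i, Fin (n i)) (Fin m) K →ₗ[K] Matrix (Σ i, Fin (n i)) (Fin m) K}

theorem mul_mem_rowFlag {k : ℕ} {w : Matrix (Σ i, Fin (n i)) (Fin m) K}
    (hw : w ∈ rowFlag K n m k) (d : Matrix (Fin m) (Fin m) K) : w * d ∈ rowFlag K n m k := by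
  intro p c hp
  rw [Matrix.mul_apply]
  exact Finset.sum_eq_zero fun r _ => by rw [hw p r hp, zero_mul]

/-- A family of homogeneous vectors with degrees in a fixed transversal of `T` stays
independent after multiplication by the homogeneous endomorphisms. -/
theorem linearIndependent_mul_homogeneous {κ : Type*} [Finite κ] {T : Subgroup G} [Finite T]
    (hρ : IsHomogeneousProj 𝒲 ρ) {X : T → Matrix (Fin m) (Fin m) K}
    (hX : ∀ s : T, X s ∈ homogeneousEnd 𝒲 (s : G)) (hu : ∀ s, IsUnit (X s))
    {v : κ → Matrix (Σ i, Fin (n i)) (Fin m) K} (hv : LinearIndependent K v) {q : κ → G ⧸ T}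
    (hq : ∀ p, v p ∈ 𝒲 (q p).out) :
    LinearIndependent K fun a : κ × T => v a.1 * X a.2 := by
  classical
  have := Fintype.ofFinite κ
  have := Fintype.ofFinite T
  rw [Fintype.linearIndependent_iff]
  rintro c hc ⟨p₀, s₀⟩
  have hterm : ∀ a : κ × T, ρ ((q p₀).out * s₀) (c a • (v a.1 * X a.2)) =
      if a.2 = s₀ then (if q a.1 = q p₀ then c a else 0) • (v a.1 * X a.2) else 0 := by
    rintro ⟨p, s⟩
    have hmem := hX s _ _ (hq p)
    rw [map_smul]
    by_cases h : s = s₀ ∧ q p = q p₀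
    · obtain ⟨rfl, h⟩ := h
      rw [if_pos rfl, if_pos h, ← h, hρ.self _ _ hmem]
    · rw [hρ.other _ _ _ hmem, smul_zero]
      · split_ifs with h1 h2
        · exact absurd ⟨h1, h2⟩ h
        · rw [zero_smul]
        · rfl
      · intro e
        have hqq : q p = q p₀ := by
          have h1 := congrArg (QuotientGroup.mk : G → G ⧸ T) e
          rw [QuotientGroup.mk_mul_of_mem _ s.2, QuotientGroup.mk_mul_of_mem _ s₀.2,
            QuotientGroup.out_eq', QuotientGroup.out_eq'] at h1
          exact h1.symm
        rw [hqq] at e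
        exact h ⟨Subtype.ext (mul_left_cancel e).symm, hqq⟩
  have h1 := congrArg (ρ ((q p₀).out * s₀)) hc
  rw [map_sum, map_zero, Fintype.sum_congr _ _ hterm, Fintype.sum_prod_type] at h1
  simp only [Finset.sum_ite_eq', Finset.mem_univ, if_true, ← Matrix.smul_mul] at h1
  rw [← Matrix.sum_mul] at h1
  have h2 : ∑ p, (if q p = q p₀ then c (p, s₀) else 0) • v p = 0 := by
    obtain ⟨e, he⟩ := (hu s₀).exists_right_inv
    rw [← Matrix.mul_one (∑ p, _), ← he, ← Matrix.mul_assoc, h1, Matrix.zero_mul]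
  have := Fintype.linearIndependent_iff.mp hv _ h2 p₀
  simpa using this

/-- A homogeneous basis of the graded module over its homogeneous endomorphisms, adapted to the
flag of submodules. -/
theorem exists_homogeneous_family (hm : 0 < m) (hρ : IsHomogeneousProj 𝒲 ρ)
    (hflag : ∀ k, ∀ w ∈ rowFlag K n m k, ∀ g, ρ g w ∈ rowFlag K n m k)
    {T : Subgroup G} {X : T → Matrix (Fin m) (Fin m) K}
    (hX : ∀ s : T, X s ∈ homogeneousEnd 𝒲 (s : G)) (hu : ∀ s, IsUnit (X s))
    (hli : LinearIndependent K X) (htop : Submodule.span K (Set.range X) = ⊤) :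
    ∃ (n' : Fin t → ℕ) (v : (Σ i, Fin (n' i)) → Matrix (Σ i, Fin (n i)) (Fin m) K)
      (γ : (Σ i, Fin (n' i)) → G),
      (∀ i, n i = n' i * m) ∧ (∀ p, v p ∈ 𝒲 (γ p)) ∧
      (∀ p, v p ∈ rowFlag K n m (p.1 + 1)) ∧
      LinearIndependent K fun a : (Σ i, Fin (n' i)) × T => v a.1 * X a.2 := by
  classical
  have hT : Finite T := hli.finite
  have := Fintype.ofFinite T
  have hcard : Fintype.card T = m * m := by
    have := Module.finrank_eq_card_basis (Module.Basis.mk hli htop.ge)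
    rw [← this, Module.finrank_matrix]
    simp
  obtain ⟨n', v, hv, hvH, hvF, hsp⟩ := exists_adapted_family (F := rowFlag K n m)
    (fun _ _ h => rowFlag_mono h) rowFlag_zero {w | ∃ q : G ⧸ T, w ∈ 𝒲 q.out} t
  choose q hq using hvH
  have hind := linearIndependent_mul_homogeneous hρ hX hu hv hq
  have hspan : ∀ k ≤ t, rowFlag K n m k = Submodule.span K (Set.range
      fun a : {a : (Σ i, Fin (n' i)) × T // a.1.1.val < k} => v a.1.1 * X a.1.2) := by
    intro k hk
    apply le_antisymm
    · intro w hw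
      refine hρ.mem_of_forall (f := LinearMap.id) fun h => ?_
      obtain ⟨s, hs⟩ := QuotientGroup.mk_out_eq_mul T h
      obtain ⟨e, he⟩ := (hu s).exists_left_inv
      obtain ⟨e', he'⟩ := (hu s⁻¹).exists_left_inv
      have hmem : ρ h w * e' ∈ Submodule.span K (v '' {p | p.1.val < k}) := by
        refine hsp k hk ⟨⟨h, ?_⟩, mul_mem_rowFlag (hflag k w hw h) e'⟩
        have h2 := inv_mem_homogeneousEnd hρ (hX s⁻¹) (mul_eq_one_comm.mp he') h _ (hρ.mem h w)
        rw [hs]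
        simpa using h2
      have heq : ρ h w = mulRightLinearMap _ K (X s⁻¹) (ρ h w * e') := by
        change ρ h w = ρ h w * e' * X s⁻¹
        rw [Matrix.mul_assoc, he', Matrix.mul_one]
      have h3 := Submodule.mem_map_of_mem (f := mulRightLinearMap _ K (X s⁻¹)) hmem
      rw [← heq, Submodule.map_span] at h3
      refine Submodule.span_mono ?_ h3
      rintro _ ⟨_, ⟨p, hp, rfl⟩, rfl⟩
      exact ⟨⟨(p, s⁻¹), hp⟩, rfl⟩
    · rw [Submodule.span_le]
      rintro _ ⟨⟨⟨p, s⟩, hp⟩, rfl⟩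
      exact mul_mem_rowFlag (rowFlag_mono hp (hvF p)) _
  have hdim : ∀ k ≤ t, (Finset.univ.filter fun p : Σ i, Fin (n i) => p.1.val < k).card * m =
      (Finset.univ.filter fun p : Σ i, Fin (n' i) => p.1.val < k).card * (m * m) := by
    intro k hk
    have hf := finrank_span_eq_card
      (hind.comp (Subtype.val : {a : (Σ i, Fin (n' i)) × T // a.1.1.val < k} → _)
        Subtype.val_injective)
    rw [← finrank_rowFlag K, hspan k hk]
    refine hf.trans ?_
    rw [← hcard, Fintype.card_subtype, ← Finset.card_univ (α := T),
      ← Finset.card_product]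
    congr 1
    ext a
    simp
  refine ⟨n', v, fun p => (q p).out, fun i => ?_, hq, hvF, hind⟩
  have h1 := hdim (i + 1) i.2
  have h0 := hdim i i.2.le
  rw [card_filter_fst_lt_succ, card_filter_fst_lt_succ, add_mul, add_mul, h0, ← mul_assoc,
    ← mul_assoc (n' i)] at h1
  exact Nat.eq_of_mul_eq_mul_right hm (Nat.add_left_cancel h1)

end

namespace UT

variable {G K : Type*} [Field K] {t : ℕ} {n : Fin t → ℕ}

theorem mem_of_forall_single (S : Submodule K (UT K n)) (a : UT K n)
    (h : ∀ (p q : Σ i, Fin (n i)) (hpq : p.1 ≤ q.1), a.1 p q ≠ 0 →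
      (⟨Matrix.single p q 1, single_mem hpq 1⟩ : UT K n) ∈ S) : a ∈ S := by
  classical
  have hmem : ∀ p q, a.1 p q • Matrix.single p q (1 : K) ∈ S.map (UT K n).val.toLinearMap := by
    intro p q
    by_cases hc : a.1 p q = 0
    · rw [hc, zero_smul]
      exact zero_mem _
    · have hpq : p.1 ≤ q.1 := not_lt.mp fun hlt => hc (apply_eq_zero a hlt)
      exact Submodule.smul_mem _ _ ⟨_, h p q hpq hc, rfl⟩
  have hsum : a.1 = ∑ p, ∑ q, a.1 p q • Matrix.single p q (1 : K) := by
    conv_lhs => rw [Matrix.matrix_eq_sum_single a.1]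
    simp
  have : a.1 ∈ S.map (UT K n).val.toLinearMap := by
    rw [hsum]
    exact Submodule.sum_mem _ fun p _ => Submodule.sum_mem _ fun q _ => hmem p q
  obtain ⟨b, hb, hba⟩ := this
  rwa [← Subtype.ext hba]

/-! ### Elementary gradings -/

variable (K) in
/-- The elementary grading of `UT(n)` defined by the family `γ`. -/
def elementaryGrading [Group G] (γ : (Σ i, Fin (n i)) → G) (g : G) : Submodule K (UT K n) where
  carrier := {a | ∀ p q, a.1 p q ≠ 0 → γ p * (γ q)⁻¹ = g}
  add_mem' := by
    intro a b ha hb p q h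
    by_cases h0 : a.1 p q = 0
    · refine hb p q fun h1 => h ?_
      change a.1 p q + b.1 p q = 0
      rw [h0, h1, add_zero]
    · exact ha p q h0
  zero_mem' := fun _ _ h => absurd rfl h
  smul_mem' := by
    intro c a ha p q h
    refine ha p q fun h0 => h ?_
    change c * a.1 p q = 0
    rw [h0, mul_zero]

theorem single_mem_elementaryGrading [Group G] (γ : (Σ i, Fin (n i)) → G)
    (p q : Σ i, Fin (n i)) (hpq : Matrix.single p q (1 : K) ∈ UT K n) :
    (⟨Matrix.single p q 1, hpq⟩ : UT K n) ∈ elementaryGrading K γ (γ p * (γ q)⁻¹) := by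
  intro a b hab
  by_cases h : p = a ∧ q = b
  · rw [h.1, h.2]
  · exact absurd (Matrix.single_apply_of_ne _ _ _ _ _ h) hab

theorem iSup_elementaryGrading [Group G] (γ : (Σ i, Fin (n i)) → G) :
    ⨆ g, elementaryGrading K γ g = ⊤ := by
  rw [eq_top_iff]
  rintro a -
  exact mem_of_forall_single _ a fun p q hpq _ =>
    Submodule.mem_iSup_of_mem _ (single_mem_elementaryGrading γ p q (single_mem hpq 1))

theorem isElementaryGrading_elementaryGrading [Group G] (γ : (Σ i, Fin (n i)) → G) :
    IsElementaryGrading (elementaryGrading K γ) := by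
  classical
  let π : G → UT K n →ₗ[K] UT K n := fun g =>
    { toFun := fun a => ⟨Matrix.of fun p q => if γ p * (γ q)⁻¹ = g then a.1 p q else 0, by
        intro p q hpq
        rw [Matrix.of_apply, apply_eq_zero a hpq, ite_self]⟩
      map_add' := by
        intro a b
        refine Subtype.ext (Matrix.ext fun p q => ?_)
        by_cases h : γ p * (γ q)⁻¹ = g <;> simp [h]
      map_smul' := by
        intro c a
        refine Subtype.ext (Matrix.ext fun p q => ?_)
        by_cases h : γ p * (γ q)⁻¹ = g <;> simp [h] }
  have hπ : ∀ g a p q, (π g a).1 p q = if γ p * (γ q)⁻¹ = g then a.1 p q else 0 :=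
    fun _ _ _ _ => rfl
  have h : IsHomogeneousProj (elementaryGrading K γ) π := by
    refine ⟨?_, ?_, ?_, iSup_elementaryGrading γ⟩
    · intro g a p q hpq
      by_contra hne
      exact hpq (by rw [hπ, if_neg hne])
    · intro g a ha
      refine Subtype.ext (Matrix.ext fun p q => ?_)
      rw [hπ]
      split_ifs with hg
      · rfl
      · by_contra hne
        exact hg (ha p q (Ne.symm hne))
    · intro g k a ha hk
      refine Subtype.ext (Matrix.ext fun p q => ?_)
      rw [hπ]
      split_ifs with hg
      · by_contra hne
        exact hk (hg.symm.trans (ha p q hne))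
      · rfl
  refine ⟨⟨h.isInternal, ?_⟩, γ, single_mem_elementaryGrading γ⟩
  intro g k a b ha hb p q hpq
  have hne : ∑ r, a.1 p r * b.1 r q ≠ 0 := hpq
  obtain ⟨r, -, hr⟩ := Finset.exists_ne_zero_of_sum_ne_zero hne
  rw [← ha p r (left_ne_zero_of_mul hr), ← hb r q (right_ne_zero_of_mul hr)]
  group

end UT

/-! ### The block Kronecker product -/

section

variable {K : Type*} [Field K] {t : ℕ} {n n' : Fin t → ℕ} {m : ℕ}

/-- Subdivision of the blocks of size `n i = n' i * m` into `n' i` pieces of size `m`. -/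
def blockEquiv (h : ∀ i, n i = n' i * m) : (Σ i, Fin (n' i)) × Fin m ≃ Σ i, Fin (n i) :=
  (Equiv.sigmaProdDistrib (fun i => Fin (n' i)) (Fin m)).trans
    (Equiv.sigmaCongrRight fun i => finProdFinEquiv.trans (finCongr (h i).symm))

theorem blockEquiv_fst (h : ∀ i, n i = n' i * m) (a : (Σ i, Fin (n' i)) × Fin m) :
    (blockEquiv h a).1 = a.1.1 := rfl

theorem blockEquiv_symm_fst (h : ∀ i, n i = n' i * m) (p : Σ i, Fin (n i)) :
    ((blockEquiv h).symm p).1.1 = p.1 := by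
  rw [← blockEquiv_fst h, Equiv.apply_symm_apply]

/-- The Kronecker product of a block upper triangular matrix and an `m × m`-matrix. -/
noncomputable def kroneckerUT (h : ∀ i, n i = n' i * m) {B : Type*} [Ring B] [Algebra K B]
    (e : B ≃ₐ[K] Matrix (Fin m) (Fin m) K) : UT K n' ⊗[K] B →ₐ[K] UT K n :=
  AlgHom.codRestrict
    ((Matrix.reindexAlgEquiv K K (blockEquiv h)).toAlgHom.comp
      ((Matrix.kroneckerAlgEquiv (Σ i, Fin (n' i)) (Fin m) K).toAlgHom.comp
        (Algebra.TensorProduct.map (UT K n').val e.toAlgHom))) (UT K n) (by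
      intro x
      induction x using TensorProduct.induction_on with
      | zero => rw [map_zero]; exact zero_mem _
      | add x y hx hy => rw [map_add]; exact add_mem hx hy
      | tmul a b =>
        intro p q hpq
        have : a.1 ((blockEquiv h).symm p).1 ((blockEquiv h).symm q).1 = 0 :=
          UT.apply_eq_zero a (by rw [blockEquiv_symm_fst, blockEquiv_symm_fst]; exact hpq)
        simp [Matrix.kroneckerMap_apply, this])

theorem kroneckerUT_tmul_apply (h : ∀ i, n i = n' i * m) {B : Type*} [Ring B] [Algebra K B]
    (e : B ≃ₐ[K] Matrix (Fin m) (Fin m) K) (a : UT K n') (b : B) (p q : Σ i, Fin (n i)) :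
    (kroneckerUT h e (a ⊗ₜ b)).1 p q =
      a.1 ((blockEquiv h).symm p).1 ((blockEquiv h).symm q).1 *
        e b ((blockEquiv h).symm p).2 ((blockEquiv h).symm q).2 := by
  simp [kroneckerUT, Matrix.kroneckerMap_apply]

theorem kroneckerUT_bijective (h : ∀ i, n i = n' i * m) {B : Type*} [Ring B] [Algebra K B]
    (e : B ≃ₐ[K] Matrix (Fin m) (Fin m) K) : Function.Bijective (kroneckerUT h e) := by
  constructor
  · intro x y hxy
    have hmap := TensorProduct.map_injective_of_flat_flat (UT K n').val.toLinearMap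
      e.toLinearMap Subtype.val_injective e.injective
    exact hmap ((Matrix.kroneckerAlgEquiv (Σ i, Fin (n' i)) (Fin m) K).injective
      ((Matrix.reindexAlgEquiv K K (blockEquiv h)).injective (congrArg Subtype.val hxy)))
  · intro z
    refine UT.mem_of_forall_single (LinearMap.range (kroneckerUT h e).toLinearMap) z
      fun p q hpq _ => ?_
    have hle : ((blockEquiv h).symm p).1.1 ≤ ((blockEquiv h).symm q).1.1 := by
      rwa [blockEquiv_symm_fst, blockEquiv_symm_fst]
    refine ⟨⟨Matrix.single _ _ 1, UT.single_mem hle 1⟩ ⊗ₜ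
      e.symm (Matrix.single ((blockEquiv h).symm p).2 ((blockEquiv h).symm q).2 1),
      Subtype.ext (Matrix.ext fun a b => ?_)⟩
    refine (kroneckerUT_tmul_apply h e _ _ a b).trans ?_
    rw [AlgEquiv.apply_symm_apply]
    change Matrix.single _ _ (1 : K) _ _ * _ = Matrix.single p q 1 a b
    simp only [Matrix.single_apply]
    by_cases hpa : p = a
    · by_cases hqb : q = b
      · simp [hpa, hqb]
      · have : ¬ (((blockEquiv h).symm q).1 = ((blockEquiv h).symm b).1 ∧
            ((blockEquiv h).symm q).2 = ((blockEquiv h).symm b).2) := fun hh =>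
          hqb ((blockEquiv h).symm.injective (Prod.ext hh.1 hh.2))
        simp only [hqb, and_false, if_false]
        grind
    · have : ¬ (((blockEquiv h).symm p).1 = ((blockEquiv h).symm a).1 ∧
            ((blockEquiv h).symm p).2 = ((blockEquiv h).symm a).2) := fun hh =>
          hpa ((blockEquiv h).symm.injective (Prod.ext hh.1 hh.2))
      simp only [hpa, false_and, if_false]
      grind

end

section

variable {G K : Type*} [CommGroup G] [Field K] {t : ℕ} {n n' : Fin t → ℕ} {m : ℕ}

/-- The square matrix whose block columns are the members of the family `v`. -/
def columnMatrix (h : ∀ i, n i = n' i * m)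
    (v : (Σ i, Fin (n' i)) → Matrix (Σ i, Fin (n i)) (Fin m) K) :
    Matrix (Σ i, Fin (n i)) (Σ i, Fin (n i)) K :=
  Matrix.of fun i j => v ((blockEquiv h).symm j).1 i ((blockEquiv h).symm j).2

theorem columnMatrix_mem (h : ∀ i, n i = n' i * m)
    {v : (Σ i, Fin (n' i)) → Matrix (Σ i, Fin (n i)) (Fin m) K}
    (hv : ∀ p, v p ∈ rowFlag K n m (p.1 + 1)) : columnMatrix h v ∈ UT K n := by
  intro i j hij
  refine hv _ i _ ?_
  rw [blockEquiv_symm_fst]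
  exact hij

theorem isUnit_columnMatrix (h : ∀ i, n i = n' i * m) (hm : 0 < m)
    {v : (Σ i, Fin (n' i)) → Matrix (Σ i, Fin (n i)) (Fin m) K} {T : Type*}
    {X : T → Matrix (Fin m) (Fin m) K} (hli : LinearIndependent K X)
    (htop : Submodule.span K (Set.range X) = ⊤)
    (hv : LinearIndependent K fun a : (Σ i, Fin (n' i)) × T => v a.1 * X a.2) :
    IsUnit (columnMatrix h v) := by
  have := hli.finite
  have := Fintype.ofFinite T
  rw [← Matrix.mulVec_injective_iff_isUnit]
  refine (injective_iff_map_eq_zero (columnMatrix h v).mulVecLin).mpr fun y hy => ?_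
  let d : (Σ i, Fin (n' i)) → Matrix (Fin m) (Fin m) K :=
    fun p => Matrix.of fun c _ => y (blockEquiv h (p, c))
  have hd : ∑ p, v p * d p = 0 := by
    ext i c
    have hi : ∑ j, columnMatrix h v i j * y j = 0 := congrFun hy i
    rw [← (blockEquiv h).sum_comp, Fintype.sum_prod_type] at hi
    rw [Matrix.sum_apply, ← hi.trans (Matrix.zero_apply i c).symm]
    refine Finset.sum_congr rfl fun p _ => ?_
    rw [Matrix.mul_apply]
    refine Finset.sum_congr rfl fun c' _ => ?_
    simp [columnMatrix, d]
  let b := Module.Basis.mk hli htop.ge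
  have hb : ∀ p, d p = ∑ s, b.repr (d p) s • X s := fun p => by
    conv_lhs => rw [← b.sum_repr (d p)]
    simp [b]
  have h0 : ∑ a : (Σ i, Fin (n' i)) × T, b.repr (d a.1) a.2 • (v a.1 * X a.2) = 0 := by
    rw [Fintype.sum_prod_type, ← hd]
    refine Finset.sum_congr rfl fun p _ => ?_
    conv_rhs => rw [hb p, Matrix.mul_sum]
    simp
  have hc := Fintype.linearIndependent_iff.mp hv _ h0
  ext j
  obtain ⟨⟨p, c⟩, rfl⟩ := (blockEquiv h).surjective j
  have : d p = 0 := by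
    rw [hb p]
    exact Finset.sum_eq_zero fun s _ => by rw [hc (p, s), zero_smul]
  exact congrFun (congrFun this c) ⟨0, hm⟩

theorem mul_columnMatrix_apply (h : ∀ i, n i = n' i * m)
    (v : (Σ i, Fin (n' i)) → Matrix (Σ i, Fin (n i)) (Fin m) K)
    (x : Matrix (Σ i, Fin (n i)) (Σ i, Fin (n i)) K) (i : Σ i, Fin (n i))
    (r : Σ i, Fin (n' i)) (c : Fin m) :
    (x * columnMatrix h v) i (blockEquiv h (r, c)) = (x * v r) i c := by
  simp [Matrix.mul_apply, columnMatrix]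

theorem columnMatrix_mul_kroneckerUT (h : ∀ i, n i = n' i * m)
    (v : (Σ i, Fin (n' i)) → Matrix (Σ i, Fin (n i)) (Fin m) K)
    {B : Type*} [Ring B] [Algebra K B] (e : B ≃ₐ[K] Matrix (Fin m) (Fin m) K)
    {p q : Σ i, Fin (n' i)} (hpq : p.1 ≤ q.1) (b : B) (i : Σ i, Fin (n i))
    (r : Σ i, Fin (n' i)) (c : Fin m) :
    (columnMatrix h v *
      (kroneckerUT h e (⟨Matrix.single p q 1, UT.single_mem hpq 1⟩ ⊗ₜ b)).1) i
        (blockEquiv h (r, c)) = if r = q then (v p * e b) i c else 0 := by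
  rw [Matrix.mul_apply, ← (blockEquiv h).sum_comp, Fintype.sum_prod_type]
  simp only [kroneckerUT_tmul_apply, Equiv.symm_apply_apply, columnMatrix, Matrix.of_apply]
  rw [Finset.sum_eq_single p]
  · by_cases hr : r = q
    · subst hr
      simp [Matrix.mul_apply]
    · simp [Ne.symm hr, hr]
  · intro p' _ hp'
    refine Finset.sum_eq_zero fun c' _ => ?_
    rw [Matrix.single_apply_of_row_ne hp'.symm, zero_mul, mul_zero]
  · exact fun hp => absurd (Finset.mem_univ p) hp

/-- An element of `UT(n)` that maps a homogeneous basis to homogeneous elements with a constant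
shift of degrees is homogeneous. -/
theorem mem_of_mul_columnMatrix {𝒰 : G → Submodule K (UT K n)} {π : G → UT K n →ₗ[K] UT K n}
    (hπ : IsHomogeneousProj 𝒰 π) {𝒲 : G → Submodule K (Matrix (Σ i, Fin (n i)) (Fin m) K)}
    {ρ : G → Matrix (Σ i, Fin (n i)) (Fin m) K →ₗ[K] Matrix (Σ i, Fin (n i)) (Fin m) K}
    (hρ : IsHomogeneousProj 𝒲 ρ) (h𝒲 : IsCompatibleGrading 𝒰 𝒲) (h : ∀ i, n i = n' i * m)
    {v : (Σ i, Fin (n' i)) → Matrix (Σ i, Fin (n i)) (Fin m) K} {γ : (Σ i, Fin (n' i)) → G}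
    (hv : ∀ p, v p ∈ 𝒲 (γ p)) (hu : IsUnit (columnMatrix h v)) {x : UT K n} {g : G}
    (hx : ∀ r, x.1 * v r ∈ 𝒲 (g * γ r)) : x ∈ 𝒰 g := by
  rw [hπ.mem_iff]
  intro k hk
  have hzero : ∀ r, (π k x).1 * v r = 0 := by
    intro r
    have h1 := hπ.map_comm (φ := fun a => a * γ r) (f := (UT.actBilin m).flip (v r)) hρ
      (mul_left_injective (γ r)) (fun a y hy => h𝒲.mul_mem a _ y _ hy (hv r)) k x
    simp only [LinearMap.flip_apply, UT.actBilin_apply] at h1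
    rw [← h1]
    exact hρ.other _ _ _ (hx r) fun e => hk (mul_right_cancel e)
  have h0 : (π k x).1 * columnMatrix h v = 0 := by
    ext i j
    obtain ⟨⟨r, c⟩, rfl⟩ := (blockEquiv h).surjective j
    rw [mul_columnMatrix_apply, hzero]
    rfl
  obtain ⟨w, hw⟩ := hu.exists_right_inv
  refine Subtype.ext ?_
  rw [← Matrix.mul_one (π k x).1, ← hw, ← Matrix.mul_assoc, h0, Matrix.zero_mul]
  rfl

theorem UT.isUnit_mk {x : Matrix (Σ i, Fin (n i)) (Σ i, Fin (n i)) K} (hx : x ∈ UT K n)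
    (hu : IsUnit x) : IsUnit (⟨x, hx⟩ : UT K n) := by
  have hdet := (Matrix.isUnit_iff_isUnit_det x).mp hu
  have := x.invertibleOfIsUnitDet hdet
  have hinv : x⁻¹ ∈ UT K n := Matrix.blockTriangular_inv_of_blockTriangular hx
  exact ⟨⟨⟨x, hx⟩, ⟨x⁻¹, hinv⟩, Subtype.ext (Matrix.mul_nonsing_inv x hdet),
    Subtype.ext (Matrix.nonsing_inv_mul x hdet)⟩, rfl⟩

theorem tensorGrading_map_le {A B C : Type*} [Ring A] [Algebra K A] [Ring B] [Algebra K B]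
    [Ring C] [Algebra K C] {𝒜 : G → Submodule K A} {ℬ : G → Submodule K B}
    {𝒞 : G → Submodule K C} {f : A ⊗[K] B →ₗ[K] C}
    (hf : ∀ g h, ∀ a ∈ 𝒜 g, ∀ b ∈ ℬ h, f (a ⊗ₜ b) ∈ 𝒞 (g * h)) (g : G) :
    (tensorGrading 𝒜 ℬ g).map f ≤ 𝒞 g := by
  rw [Submodule.map_le_iff_le_comap, tensorGrading, Submodule.span_le]
  rintro _ ⟨h, k, rfl, a, ha, b, hb, rfl⟩
  exact hf h k a ha b hb

theorem iSup_tensorGrading {A B : Type*} [Ring A] [Algebra K A] [Ring B] [Algebra K B]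
    {𝒜 : G → Submodule K A} {ℬ : G → Submodule K B} (hA : ⨆ g, 𝒜 g = ⊤) (hB : ⨆ g, ℬ g = ⊤) :
    ⨆ g, tensorGrading 𝒜 ℬ g = ⊤ := by
  rw [eq_top_iff]
  rintro x -
  induction x using TensorProduct.induction_on with
  | zero => exact zero_mem _
  | add x y hx hy => exact add_mem hx hy
  | tmul a b =>
    have ha : a ∈ ⨆ g, 𝒜 g := by rw [hA]; trivial
    have hb : b ∈ ⨆ g, ℬ g := by rw [hB]; trivial
    induction ha using Submodule.iSup_induction' with
    | zero => rw [TensorProduct.zero_tmul]; exact zero_mem _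
    | add a a' _ _ h h' => rw [TensorProduct.add_tmul]; exact add_mem h h'
    | mem g a ha =>
      induction hb using Submodule.iSup_induction' with
      | zero => rw [TensorProduct.tmul_zero]; exact zero_mem _
      | add b b' _ _ h h' => rw [TensorProduct.tmul_add]; exact add_mem h h'
      | mem k b hb =>
        exact Submodule.mem_iSup_of_mem (g * k)
          (Submodule.subset_span ⟨g, k, rfl, a, ha, b, hb, rfl⟩)

theorem TwistedGroupAlgebra.iSup_grading {T : Subgroup G} (σ : TwoCocycle T K) :
    ⨆ g, TwistedGroupAlgebra.grading σ g = ⊤ := by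
  rw [eq_top_iff]
  rintro x -
  refine Submodule.span_le.mpr ?_ (TwistedGroupAlgebra.span_grading σ x)
  rintro _ ⟨s, rfl⟩
  exact Submodule.mem_iSup_of_mem (s : G) (Submodule.subset_span ⟨s, rfl, rfl⟩)

theorem isGradedIso_symm {G K A B : Type*} [Field K] [Ring A] [Algebra K A] [Ring B] [Algebra K B]
    {𝒜 : G → Submodule K A} {ℬ : G → Submodule K B} {e : A ≃ₐ[K] B}
    (h : ∀ g, (𝒜 g).map (e : A →ₐ[K] B).toLinearMap = ℬ g) : IsGradedIso ℬ 𝒜 e.symm := by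
  intro g
  ext x
  constructor
  · rintro ⟨y, hy, rfl⟩
    rw [SetLike.mem_coe, ← h g] at hy
    obtain ⟨z, hz, rfl⟩ := hy
    change e.symm (e z) ∈ 𝒜 g
    rwa [AlgEquiv.symm_apply_apply]
  · intro hx
    refine ⟨e x, ?_, e.symm_apply_apply x⟩
    rw [← h g]
    exact ⟨x, hx, rfl⟩

/-- The block Kronecker product, followed by a conjugation. -/
theorem exists_algEquiv_conj (h : ∀ i, n i = n' i * m) {B : Type*} [Ring B] [Algebra K B]
    (ε : B ≃ₐ[K] Matrix (Fin m) (Fin m) K) (u : (UT K n)ˣ) :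
    ∃ e : UT K n' ⊗[K] B ≃ₐ[K] UT K n, ∀ x, e x * u.1 = u.1 * kroneckerUT h ε x := by
  refine ⟨(AlgEquiv.ofBijective (kroneckerUT h ε) (kroneckerUT_bijective h ε)).trans
    (MulSemiringAction.toAlgEquiv K (UT K n) (ConjAct.toConjAct u)), fun x => ?_⟩
  have h1 : ∀ y : UT K n, u.1 * y * u⁻¹.1 * u.1 = u.1 * y := fun y => by
    rw [mul_assoc, Units.inv_mul, mul_one]
  exact h1 (kroneckerUT h ε x)

theorem map_single_tmul_mem {𝒰 : G → Submodule K (UT K n)} (h𝒰 : IsGroupGrading 𝒰)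
    {𝒲 : G → Submodule K (Matrix (Σ i, Fin (n i)) (Fin m) K)}
    (h𝒲 : IsCompatibleGrading 𝒰 𝒲) (h : ∀ i, n i = n' i * m)
    {v : (Σ i, Fin (n' i)) → Matrix (Σ i, Fin (n i)) (Fin m) K} {γ : (Σ i, Fin (n' i)) → G}
    (hv : ∀ p, v p ∈ 𝒲 (γ p)) (hu : IsUnit (columnMatrix h v))
    {B : Type*} [Ring B] [Algebra K B] (ε : B ≃ₐ[K] Matrix (Fin m) (Fin m) K) {s : G} {b : B}
    (hb : ε b ∈ homogeneousEnd 𝒲 s) {p q : Σ i, Fin (n' i)} (hpq : p.1 ≤ q.1) {x : UT K n}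
    (hx : x.1 * columnMatrix h v = columnMatrix h v *
      (kroneckerUT h ε (⟨Matrix.single p q 1, UT.single_mem hpq 1⟩ ⊗ₜ b)).1) :
    x ∈ 𝒰 (γ p * (γ q)⁻¹ * s) := by
  obtain ⟨π, hπ⟩ := exists_isHomogeneousProj h𝒰.isInternal
  obtain ⟨ρ, hρ⟩ := exists_isHomogeneousProj h𝒲.isInternal
  refine mem_of_mul_columnMatrix hπ hρ h𝒲 h hv hu fun r => ?_
  have hxr : ∀ i c, (x.1 * v r) i c = if r = q then (v p * ε b) i c else 0 := by
    intro i c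
    rw [← mul_columnMatrix_apply h v x.1 i r c, hx]
    exact columnMatrix_mul_kroneckerUT h v ε hpq b i r c
  by_cases hr : r = q
  · subst hr
    have : γ p * (γ r)⁻¹ * s * γ r = γ p * s := by
      rw [mul_right_comm, inv_mul_cancel_right]
    rw [this, Matrix.ext fun i c => (hxr i c).trans (if_pos rfl)]
    exact hb _ _ (hv p)
  · have h0 : x.1 * v r = 0 := Matrix.ext fun i c => (hxr i c).trans (if_neg hr)
    rw [h0]
    exact zero_mem _

theorem isGradedIso_of_tmul_mem {A B C : Type*} [Ring A] [Algebra K A] [Ring B] [Algebra K B]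
    [Ring C] [Algebra K C] {𝒜 : G → Submodule K A} {ℬ : G → Submodule K B}
    {𝒞 : G → Submodule K C} {π : G → C →ₗ[K] C} (hπ : IsHomogeneousProj 𝒞 π)
    (hA : ⨆ g, 𝒜 g = ⊤) (hB : ⨆ g, ℬ g = ⊤) (e : A ⊗[K] B ≃ₐ[K] C)
    (he : ∀ g h, ∀ a ∈ 𝒜 g, ∀ b ∈ ℬ h, e (a ⊗ₜ b) ∈ 𝒞 (g * h)) :
    IsGradedIso 𝒞 (tensorGrading 𝒜 ℬ) e.symm := by
  have htop : ⨆ g, (tensorGrading 𝒜 ℬ g).map (e : A ⊗[K] B →ₐ[K] C).toLinearMap = ⊤ := by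
    rw [← Submodule.map_iSup, iSup_tensorGrading hA hB, Submodule.map_top,
      LinearMap.range_eq_top]
    exact e.surjective
  exact isGradedIso_symm fun g => hπ.eq_of_le (tensorGrading_map_le he) htop g

theorem map_tmul_mem_of_single {C : Type*} [Ring C] [Algebra K C]
    {𝒞 : G → Submodule K C} {γ : (Σ i, Fin (n' i)) → G} {T : Subgroup G} {σ : TwoCocycle T K}
    (f : UT K n' ⊗[K] TwistedGroupAlgebra σ →ₗ[K] C)
    (hf : ∀ (p q : Σ i, Fin (n' i)) (hpq : p.1 ≤ q.1) (s : T),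
      f (⟨Matrix.single p q 1, UT.single_mem hpq 1⟩ ⊗ₜ TwistedGroupAlgebra.single σ s 1) ∈
        𝒞 (γ p * (γ q)⁻¹ * s)) (g k : G) (a : UT K n') (ha : a ∈ UT.elementaryGrading K γ g)
    (b : TwistedGroupAlgebra σ) (hb : b ∈ TwistedGroupAlgebra.grading σ k) :
    f (a ⊗ₜ b) ∈ 𝒞 (g * k) := by
  have hb' : TwistedGroupAlgebra.grading σ k ≤
      (𝒞 (g * k)).comap (f ∘ₗ TensorProduct.mk K _ _ a) := by
    refine Submodule.span_le.mpr ?_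
    rintro _ ⟨s, rfl, rfl⟩
    refine UT.mem_of_forall_single ((𝒞 (g * s)).comap (f ∘ₗ
      (TensorProduct.mk K _ _).flip (TwistedGroupAlgebra.single σ s 1))) a
        fun p q hpq hne => ?_
    rw [← ha p q hne]
    exact hf p q hpq s
  exact hb' hb

end

section

variable {G K : Type*} [CommGroup G] [Field K]

theorem linearIndependent_one_of_unique {T : Type*} [Unique T] :
    LinearIndependent K (fun _ : T => (1 : Matrix (Fin 1) (Fin 1) K)) :=
  LinearIndependent.of_subsingleton default one_ne_zero

theorem span_range_one_of_nonempty {T : Type*} [Nonempty T] :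
    Submodule.span K (Set.range fun _ : T => (1 : Matrix (Fin 1) (Fin 1) K)) = ⊤ := by
  rw [eq_top_iff]
  rintro d -
  have : d = d 0 0 • 1 := by
    ext i j
    rw [Subsingleton.elim i 0, Subsingleton.elim j 0]
    simp
  rw [this]
  exact Submodule.smul_mem _ _ (Submodule.subset_span ⟨Classical.arbitrary T, rfl⟩)

/-- The case of no blocks: `UT(n)` is the zero algebra. -/
theorem exists_gradedIso_of_isEmpty (n : Fin 0 → ℕ) (𝒰 : G → Submodule K (UT K n)) :
    ∃ (T : Subgroup G) (σ : TwoCocycle T K) (m : ℕ) (n' : Fin 0 → ℕ)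
      (𝒰' : G → Submodule K (UT K n')),
      Finite T ∧
      Nat.card T = m ^ 2 ∧
      Nonempty (TwistedGroupAlgebra σ ≃ₐ[K] Matrix (Fin m) (Fin m) K) ∧
      (∀ i, n i = n' i * m) ∧
      IsElementaryGrading 𝒰' ∧
      ∃ e : UT K n ≃ₐ[K] (UT K n' ⊗[K] TwistedGroupAlgebra σ),
        IsGradedIso 𝒰 (tensorGrading 𝒰' (TwistedGroupAlgebra.grading σ)) e := by
  have hli := linearIndependent_one_of_unique (K := K) (T := (⊥ : Subgroup G))
  obtain ⟨σ, hσ⟩ := exists_twoCocycle hli fun _ _ => ⟨1, by simp⟩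
  obtain ⟨ε, -⟩ := TwistedGroupAlgebra.exists_algEquiv σ hli span_range_one_of_nonempty hσ
  have h : ∀ i, n i = n i * 1 := fun i => (mul_one _).symm
  have hs : Subsingleton (UT K n) :=
    ⟨fun x y => Subtype.ext (Matrix.ext fun p => p.1.elim0)⟩
  let e := AlgEquiv.ofBijective (kroneckerUT h ε) (kroneckerUT_bijective h ε)
  have hs' : Subsingleton (UT K n ⊗[K] TwistedGroupAlgebra σ) := e.injective.subsingleton
  refine ⟨⊥, σ, 1, n, UT.elementaryGrading K fun _ => 1, inferInstance, by simp, ⟨ε⟩, h,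
    UT.isElementaryGrading_elementaryGrading _, e.symm, fun g => ?_⟩
  ext x
  rw [Subsingleton.elim x 0]
  exact ⟨fun _ => zero_mem _, fun _ => zero_mem _⟩

end

theorem mainTheorem3 {G K : Type*} [CommGroup G] [Field K] [IsAlgClosed K] [CharZero K]
    {t : ℕ} (n : Fin t → ℕ) (hn : ∀ i, 0 < n i)
    (𝒰 : G → Submodule K (UT K n)) (h𝒰 : IsGroupGrading 𝒰) :
    ∃ (T : Subgroup G) (σ : TwoCocycle T K) (m : ℕ) (n' : Fin t → ℕ)
      (𝒰' : G → Submodule K (UT K n')),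
      Finite T ∧
      Nat.card T = m ^ 2 ∧
      Nonempty (TwistedGroupAlgebra σ ≃ₐ[K] Matrix (Fin m) (Fin m) K) ∧
      (∀ i, n i = n' i * m) ∧
      IsElementaryGrading 𝒰' ∧
      ∃ e : UT K n ≃ₐ[K] (UT K n' ⊗[K] TwistedGroupAlgebra σ),
        IsGradedIso 𝒰 (tensorGrading 𝒰' (TwistedGroupAlgebra.grading σ)) e := by
  classical
  rcases t with _ | t
  · exact exists_gradedIso_of_isEmpty n 𝒰
  have hl : ∀ i, i ≤ Fin.last t := Fin.le_last
  have : Nonempty (Σ i, Fin (n i)) := ⟨⟨Fin.last t, ⟨0, hn _⟩⟩⟩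
  have hex : ∃ m, 0 < m ∧ ∃ 𝒲 : G → Submodule K (Matrix (Σ i, Fin (n i)) (Fin m) K),
      IsCompatibleGrading 𝒰 𝒲 := ⟨_, hn _, exists_isCompatibleGrading hn h𝒰 hl⟩
  obtain ⟨m, ⟨hm, 𝒲, h𝒲⟩, hmin⟩ :
      ∃ m, (0 < m ∧ ∃ 𝒲 : G → Submodule K (Matrix (Σ i, Fin (n i)) (Fin m) K),
        IsCompatibleGrading 𝒰 𝒲) ∧ ∀ r, 0 < r →
          (∃ 𝒲 : G → Submodule K (Matrix (Σ i, Fin (n i)) (Fin r) K),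
            IsCompatibleGrading 𝒰 𝒲) → m ≤ r :=
    ⟨Nat.find hex, Nat.find_spec hex, fun r hr h => Nat.find_min' hex ⟨hr, h⟩⟩
  obtain ⟨π, hπ⟩ := exists_isHomogeneousProj h𝒰.isInternal
  obtain ⟨ρ, hρ⟩ := exists_isHomogeneousProj h𝒲.isInternal
  obtain ⟨T, X, hX, hXu, hli, htop, hmul⟩ := exists_homogeneous_basis_of_isUnit hm hρ
    (fun s d hd h0 => isUnit_of_mem_homogeneousEnd h𝒲 hmin hd h0)
    (iSup_homogeneousEnd hn h𝒰 hl h𝒲)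
  obtain ⟨σ, hσ⟩ := exists_twoCocycle hli hmul
  obtain ⟨ε, hε⟩ := TwistedGroupAlgebra.exists_algEquiv σ hli htop hσ
  obtain ⟨n', v, γ, h, hv, hflag, hind⟩ := exists_homogeneous_family hm hρ
    (h𝒲.proj_mem_rowFlag hn h𝒰 hπ hρ) hX hXu hli htop
  have hu := isUnit_columnMatrix h hm hli htop hind
  obtain ⟨u, huV⟩ := UT.isUnit_mk (columnMatrix_mem h hflag) hu
  obtain ⟨e, he⟩ := exists_algEquiv_conj h ε u
  have hT : Nat.card T = m ^ 2 := by
    rw [← Module.finrank_eq_nat_card_basis (Module.Basis.mk hli htop.ge), Module.finrank_matrix]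
    simp [sq]
  refine ⟨T, σ, m, n', UT.elementaryGrading K γ, hli.finite, hT, ⟨ε⟩, h,
    UT.isElementaryGrading_elementaryGrading γ, e.symm,
    isGradedIso_of_tmul_mem hπ (UT.iSup_elementaryGrading γ)
      (TwistedGroupAlgebra.iSup_grading σ) e
      (map_tmul_mem_of_single e.toAlgHom.toLinearMap fun p q hpq s => ?_)⟩
  refine map_single_tmul_mem h𝒰 h𝒲 h hv hu ε (s := (s : G))
    (b := TwistedGroupAlgebra.single σ s 1) (by rw [hε, one_smul]; exact hX s) hpq ?_
  have h1 := congrArg Subtype.val (he (⟨Matrix.single p q 1, UT.single_mem hpq 1⟩ ⊗ₜ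
    TwistedGroupAlgebra.single σ s 1))
  rw [huV] at h1
  exact h1
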